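/- Let $N\ge 0$ be an integer, $T>0$, and let $f:\mathbb{R}^N\times\mathbb{R}\to\mathbb{R}^N$ be a $C^1$ function with $f(x,t+T)=f(x,t)$ for all $x\in\mathbb{R}^N$, $t\in\mathbb{R}$. Let $x_*:\mathbb{R}\to\mathbb{R}^N$ be a solution of $\dot x(t)=f(x(t),t)$ with $x_*(t+T)=x_*(t)$ for all $t$ (the period $T$ need not be minimal in either case). Let $Y_0(t)\in\mathbb{R}^{N\times N}$, $t\ge 0$, be the fundamental solution of the linearized equation $\dot y(t)=\partial_x f(x_*(t),t)\,y(t)$, that is, $\dot Y_0(t)=\partial_x f(x_*(t),t)\,Y_0(t)$ and $Y_0(0)=I$; the Floquet multipliers are the eigenvalues in $\mathbb{C}$ of $Y_0(T)$. Suppose that there is at least one real Floquet multiplier $\mu>1$. Then for every $k\in\mathbb{R}$, $x_*$ is (Lyapunov) unstable as a solution of the controlled delay equation $$\dot x(t)=f(x(t),t)+k\,[x(t)-x(t-T)],\qquad t\ge 0,$$ with initial data in $C([-T,0],\mathbb{R}^N)$. Explicitly: there is $\varepsilon>0$ such that for every $\delta>0$ there are $s\ge 0$ and a continuous $x:[-T,s]\to\mathbb{R}^N$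 that satisfies the controlled equation on $[0,s]$, with $\sup_{\theta\in[-T,0]}|x(\theta)-x_*(\theta)|<\delta$ and $|x(t)-x_*(t)|\ge\varepsilon$ for some $t\in[0,s]$. -/

import Mathlib

open Set

/-- The state space `ℝ^N` with its Euclidean norm. -/
abbrev State (N : ℕ) : Type := EuclideanSpace ℝ (Fin N)

/-- `x` is a solution, with (not necessarily minimal) period `T`, of the ODE `x'(t) = f(x(t), t)`. -/
def IsPeriodicSolution {N : ℕ} (f : State N → ℝ → State N) (T : ℝ) (x : ℝ → State N) : Prop :=
  Function.Periodic x T ∧ ∀ t : ℝ, HasDerivAt x (f (x t) t) t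

/-- The coefficient `t ↦ ∂ₓ f(x(t), t)` of the linearized equation
`y'(t) = ∂ₓ f(x(t), t) y(t)` along `x`. -/
noncomputable def linearization {N : ℕ} (f : State N → ℝ → State N) (x : ℝ → State N) :
    ℝ → (State N →L[ℝ] State N) :=
  fun t => fderiv ℝ (fun z => f z t) (x t)

/-- `Y` is the fundamental solution on `[0, ∞)` of `y'(t) = A(t) y(t)`:
`Y' = A Y` and `Y(0) = I`. -/
def IsFundamentalSolution {N : ℕ} (A Y : ℝ → (State N →L[ℝ] State N)) : Prop :=
  Y 0 = ContinuousLinearMap.id ℝ (State N) ∧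
    ∀ t ∈ Ici (0 : ℝ), HasDerivWithinAt Y ((A t).comp (Y t)) (Ici 0) t

/-- The matrix, with complex entries, of a real linear map of `ℝ^N` in the standard basis. -/
noncomputable def complexMatrix {N : ℕ} (L : State N →L[ℝ] State N) :
    Matrix (Fin N) (Fin N) ℂ :=
  (LinearMap.toMatrix (EuclideanSpace.basisFun (Fin N) ℝ).toBasis
    (EuclideanSpace.basisFun (Fin N) ℝ).toBasis (L : State N →ₗ[ℝ] State N)).map
      (fun r : ℝ => (r : ℂ))

/-- `μ ∈ ℂ` is a Floquet multiplier of the `T`-periodic linear ODE `y'(t) = A(t) y(t)`: an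
eigenvalue, with eigenvector in `ℂ^N`, of the monodromy operator `Y(T)`. -/
def IsFloquetMultiplier {N : ℕ} (A : ℝ → (State N →L[ℝ] State N)) (T : ℝ) (μ : ℂ) : Prop :=
  ∃ Y : ℝ → (State N →L[ℝ] State N), IsFundamentalSolution A Y ∧
    Module.End.HasEigenvalue (Matrix.toLin' (complexMatrix (Y T))) μ

/-- `x`, restricted to `[-T, s]`, is a solution of the controlled equation
`x'(t) = f(x(t), t) + k [x(t) - x(t - T)]` for `t ∈ [0, s]`; its initial datum is the
continuous function `x` on `[-T, 0]`. -/
def IsControlledSolution {N : ℕ} (f : State N → ℝ → State N) (k T s : ℝ)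
    (x : ℝ → State N) : Prop :=
  ContinuousOn x (Icc (-T) s) ∧
    ∀ t ∈ Icc (0 : ℝ) s,
      HasDerivWithinAt x (f (x t) t + k • (x t - x (t - T))) (Icc 0 s) t

/-- Lyapunov stability of `xs` as a solution of the controlled equation, with initial data at
time `0` in `C([-T, 0], ℝ^N)` and the supremum norm. All solutions on all intervals `[-T, s]` are
considered, so that a solution which blows up in finite time also counts as leaving `xs`. -/
def IsControlledStable {N : ℕ} (f : State N → ℝ → State N) (k T : ℝ)
    (xs : ℝ → State N) : Prop :=
  ∀ ε > 0, ∃ δ > 0, ∀ (s : ℝ) (x : ℝ → State N), IsControlledSolution f k T s x →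
    (∀ θ ∈ Icc (-T) 0, ‖x θ - xs θ‖ < δ) → ∀ t ∈ Icc 0 s, ‖x t - xs t‖ < ε

/-- `xs` is unstable as a solution of the controlled equation. -/
def IsControlledUnstable {N : ℕ} (f : State N → ℝ → State N) (k T : ℝ)
    (xs : ℝ → State N) : Prop :=
  ¬ IsControlledStable f k T xs

/-! The deviation `w = x - xs` solves `w' = f(xs + w, t) - f(xs, t) + k w - k w(t - T)`. Cut `w`
into segments of length `T` and pass to the coordinates `p_j(τ) = exp(-kτ) Y(τ)⁻¹ w(jT - T + τ)` on
`[0, T]`. These remove the linear terms without delay, so that to first order `p_{j+1}' = -k p_j`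
and `p_{j+1}(0) = M p_j(T)` with `M = exp(kT) Y(T)`. The linearized period map is thus `U z (t) = M
z(T) - k ∫₀ᵗ z` (`segmentOperator`), a compact operator.

If `Y(T) v = μ v`, then `exp(-k t / lam) v` is an eigenfunction of `U` for `lam` as soon as `lam = μ
exp(kT (1 - 1 / lam))`. At `lam = 1` the right side is `μ > 1`, and it is bounded on `[1, ∞)`, so a
root `lam > 1` exists for every `k`.

It remains to pass from `U` to the nonlinear equation.
`IsCompactOperator.exists_dominated_splitting` provides an invariant cone around the expanding
directions, and `IsCompactOperator.exists_forall_orbit_unbounded` shows that approximate orbits of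
`U` starting on the eigenvector leave every ball. Stability would keep the segments so small that
they form such an approximate orbit (`norm_pullback_segment_sub_le`) and yet stay bounded. Clamping
the vector field makes the solutions global, so that the orbit can be followed for as long as
needed. -/

/-! ### Spectrum of a compact operator outside the closed unit disc -/

section CompactSpectrum

variable {X : Type*} [NormedAddCommGroup X] [NormedSpace ℂ X]

/-- A finite-dimensional `U`-invariant subspace on which all eigenvalues of `U` have modulus
greater than one. -/
structure IsExpandingSubspace (U : X →L[ℂ] X) (W : Submodule ℂ X) : Prop where
  finite : FiniteDimensional ℂ W
  invariant : ∀ w ∈ W, U w ∈ W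
  one_lt : ∀ (c : ℂ), ∀ w ∈ W, w ≠ 0 → U w = c • w → 1 < ‖c‖

theorem IsExpandingSubspace.bot (U : X →L[ℂ] X) : IsExpandingSubspace U ⊥ where
  finite := inferInstance
  invariant := by simp
  one_lt := fun c w hw h0 _ => absurd ((Submodule.mem_bot ℂ).1 hw) h0

/-- `U - z` preserves `W` and sends `x` into `W`. -/
theorem IsExpandingSubspace.sub_smul_mem {U : X →L[ℂ] X} {W : Submodule ℂ X}
    (hW : IsExpandingSubspace U W) {z : ℂ} {x : X} (hx : U x - z • x ∈ W) :
    ∀ w ∈ W ⊔ Submodule.span ℂ {x}, U w - z • w ∈ W := by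
  intro w hw
  obtain ⟨a, ha, b, hb, rfl⟩ := Submodule.mem_sup.1 hw
  obtain ⟨c, rfl⟩ := Submodule.mem_span_singleton.1 hb
  have h : U (a + c • x) - z • (a + c • x) = (U a - z • a) + c • (U x - z • x) := by
    simp only [map_add, map_smul]; module
  rw [h]
  exact W.add_mem (W.sub_mem (hW.invariant a ha) (W.smul_mem _ ha)) (W.smul_mem _ hx)

/-- If `U w = c w` in the larger space, then `(c - z) w ∈ W`; so either `c = z`, or `w` already lies
in `W`. -/
theorem IsExpandingSubspace.sup_span {U : X →L[ℂ] X} {W : Submodule ℂ X}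
    (hW : IsExpandingSubspace U W) {z : ℂ} (hz : 1 < ‖z‖) {x : X} (hx : U x - z • x ∈ W) :
    IsExpandingSubspace U (W ⊔ Submodule.span ℂ {x}) where
  finite := by
    have := hW.finite
    infer_instance
  invariant := fun w hw => by
    have h := (le_sup_left : W ≤ W ⊔ Submodule.span ℂ {x}) (hW.sub_smul_mem hx w hw)
    simpa using Submodule.add_mem _ h (Submodule.smul_mem _ z hw)
  one_lt := fun c w hw h0 hc => by
    have h := hW.sub_smul_mem hx w hw
    rw [hc, ← sub_smul] at h
    by_cases hcz : c = z
    · rwa [hcz]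
    · exact hW.one_lt c w ((Submodule.smul_mem_iff _ (sub_ne_zero.2 hcz)).1 h) h0 hc

/-- A compact operator has an expanding subspace that captures all of the spectrum outside the
closed unit disc. -/
theorem IsCompactOperator.exists_maximal_isExpandingSubspace {U : X →L[ℂ] X}
    (hU : IsCompactOperator U) :
    ∃ W, IsExpandingSubspace U W ∧ ∀ (x : X) (z : ℂ), 1 < ‖z‖ → U x - z • x ∈ W → x ∈ W := by
  by_contra! hcon
  have step : ∀ W : {W // IsExpandingSubspace U W}, ∃ W' : {W // IsExpandingSubspace U W},
      W.1 ≤ W'.1 ∧ (∃ x ∈ W'.1, x ∉ W.1) ∧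
      ∃ z : ℂ, 1 < ‖z‖ ∧ ∀ w ∈ W'.1, U w - z • w ∈ W.1 := by
    rintro ⟨W, hW⟩
    obtain ⟨x, z, hz, hx, hxW⟩ := hcon W hW
    exact ⟨⟨_, hW.sup_span hz hx⟩, le_sup_left,
      ⟨x, (le_sup_right : _ ≤ W ⊔ Submodule.span ℂ {x}) (Submodule.mem_span_singleton_self x), hxW⟩,
      z, hz, hW.sub_smul_mem hx⟩
  choose next hle hne z hz hsub using step
  -- Without a maximal subspace there is a strictly increasing chain `V n`. Riesz's lemma picks unit
  -- vectors `f n ∈ V (n + 1)` at distance at least `1 / 2` from `V n`.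
  let V : ℕ → {W // IsExpandingSubspace U W} := fun n => next^[n] ⟨⊥, .bot U⟩
  have hV : ∀ n, V (n + 1) = next (V n) := fun n => Function.iterate_succ_apply' _ _ _
  have hmono : Monotone fun n => (V n).1 :=
    monotone_nat_of_le_succ fun n => by rw [hV]; exact hle _
  have hR : ∀ n, ∃ x ∈ (V (n + 1)).1, ‖x‖ = 1 ∧ ∀ y ∈ (V n).1, 1 / 2 ≤ ‖x - y‖ := by
    intro n
    have hfin := (V n).2.finite
    have hcl : IsClosed (((V n).1.comap (V (n + 1)).1.subtype : Submodule ℂ (V (n + 1)).1) :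
        Set (V (n + 1)).1) :=
      (Submodule.closed_of_finiteDimensional (V n).1).preimage continuous_subtype_val
    obtain ⟨x₀, hx₀, hx₀'⟩ := hne (V n)
    rw [← hV] at hx₀
    obtain ⟨x, -, hx1, hx⟩ := riesz_lemma_of_lt_one hcl ⟨⟨x₀, hx₀⟩, hx₀'⟩
      (by norm_num : (1 / 2 : ℝ) < 1)
    exact ⟨x, x.2, hx1, fun y hy =>
      hx ⟨y, hmono (Nat.le_succ n) hy⟩ hy⟩
  choose f hfV hf1 hf using hR
  have hfar : ∀ m n, m < n → 1 / 2 ≤ ‖U (f n) - U (f m)‖ := by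
    intro m n hmn
    have hzn := hz (V n)
    have hz0 : z (V n) ≠ 0 := norm_pos_iff.1 (by linarith)
    have h1 : U (f n) - z (V n) • f n ∈ (V n).1 := hsub (V n) _ (by rw [← hV]; exact hfV n)
    have h2 : U (f m) ∈ (V n).1 := hmono hmn ((V (m + 1)).2.invariant _ (hfV m))
    have h3 := hf n _ ((V n).1.smul_mem (-(z (V n))⁻¹) ((V n).1.sub_mem h1 h2))
    -- The difference is `z` times (`f n` minus an element of `V n`), and `|z| > 1`; so the images
    -- stay `1 / 2` apart, against compactness.
    have h4 : U (f n) - U (f m) = z (V n) •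
        (f n - (-(z (V n))⁻¹) • (U (f n) - z (V n) • f n - U (f m))) := by
      rw [smul_sub, smul_smul, mul_neg, mul_inv_cancel₀ hz0]; module
    rw [h4, norm_smul]
    nlinarith [norm_nonneg (f n - (-(z (V n))⁻¹) • (U (f n) - z (V n) • f n - U (f m)))]
  obtain ⟨K, hK, hK'⟩ := hU.image_closedBall_subset_compact (1 : ℝ)
  obtain ⟨y, -, ψ, hψ, hψy⟩ := hK.tendsto_subseq (x := fun n => U (f n))
    fun n => hK' ⟨f n, by simp [hf1], rfl⟩
  obtain ⟨n, hn⟩ := Metric.cauchySeq_iff'.1 hψy.cauchySeq (1 / 2) (by norm_num)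
  have := hn (n + 1) (Nat.le_succ n)
  rw [dist_eq_norm] at this
  exact absurd (hfar _ _ (hψ (Nat.lt_succ_self n))) (not_le.2 this)

end CompactSpectrum

/-! ### Growth of powers from spectral bounds -/

section Gelfand

variable {A : Type*} [NormedRing A] [NormedAlgebra ℂ A] [CompleteSpace A]

theorem eventually_norm_pow_le_of_spectralRadius_lt {a : A} {r : NNReal}
    (h : spectralRadius ℂ a < r) : ∀ᶠ n : ℕ in Filter.atTop, ‖a ^ n‖ ≤ (r : ℝ) ^ n := by
  have := (spectrum.pow_nnnorm_pow_one_div_tendsto_nhds_spectralRadius a).eventually_lt_const h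
  filter_upwards [this, Filter.eventually_gt_atTop 0] with n hn hn0
  have hn' : (0 : ℝ) < n := by exact_mod_cast hn0
  have h1 := ENNReal.rpow_le_rpow hn.le hn'.le
  rw [← ENNReal.rpow_mul, one_div_mul_cancel hn'.ne', ENNReal.rpow_one, ENNReal.rpow_natCast] at h1
  exact_mod_cast h1

theorem spectralRadius_lt_of_forall_norm_lt {a : A} {r : NNReal} (hr : 0 < r)
    (h : ∀ z ∈ spectrum ℂ a, ‖z‖ < r) : spectralRadius ℂ a < r := by
  rcases subsingleton_or_nontrivial A with hA | hA
  · simpa [spectrum.SpectralRadius.of_subsingleton] using hr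
  · exact spectrum.spectralRadius_lt_of_forall_lt a fun z hz => by exact_mod_cast h z hz

end Gelfand

section GelfandInverse

variable {A : Type*} [NormedRing A] [NormedAlgebra ℂ A] [CompleteSpace A]

theorem eventually_norm_pow_le_of_forall_norm_le {a : A} {r : ℝ} (hr : 0 ≤ r)
    (h : ∀ c ∈ spectrum ℂ a, ‖c‖ ≤ r) {s : ℝ} (hrs : r < s) :
    ∀ᶠ n : ℕ in Filter.atTop, ‖a ^ n‖ ≤ s ^ n := by
  lift s to NNReal using hr.trans hrs.le
  exact eventually_norm_pow_le_of_spectralRadius_lt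
    (spectralRadius_lt_of_forall_norm_lt (by exact_mod_cast hr.trans_lt hrs)
      fun z hz => (h z hz).trans_lt hrs)

/-- The spectrum of `a⁻¹` consists of the reciprocals, so its spectral radius is below one, and
Gelfand's formula applies to any `r` in between. -/
theorem exists_inverse_norm_pow_le {a : A} (h : ∀ c ∈ spectrum ℂ a, 1 < ‖c‖) :
    ∃ (b : A) (r : ℝ), 0 < r ∧ r < 1 ∧ (∀ n : ℕ, b ^ n * a ^ n = 1) ∧
      ∀ᶠ n : ℕ in Filter.atTop, ‖b ^ n‖ ≤ r ^ n := by
  have ha : IsUnit a := by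
    rw [← spectrum.zero_notMem_iff ℂ]
    intro h0
    have := h 0 h0
    norm_num at this
  obtain ⟨u, rfl⟩ := ha
  have hlt : spectralRadius ℂ ((u⁻¹ : Aˣ) : A) < (1 : NNReal) := by
    refine spectralRadius_lt_of_forall_norm_lt one_pos fun z hz => ?_
    have hz0 : z ≠ 0 := spectrum.ne_zero_of_mem_of_unit hz
    have h1 := h z⁻¹ (by
      have := spectrum.inv_mem_iff (r := Units.mk0 z hz0) (a := u⁻¹)
      simpa using this.1 (by simpa using hz))
    rw [norm_inv] at h1
    simpa using (one_lt_inv₀ (norm_pos_iff.2 hz0)).1 h1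
  obtain ⟨r, hr, hr1⟩ := ENNReal.lt_iff_exists_nnreal_btwn.1 hlt
  have hr0 : 0 < r := by exact_mod_cast (zero_le (a := spectralRadius ℂ _)).trans_lt hr
  refine ⟨↑u⁻¹, r, by exact_mod_cast hr0, by exact_mod_cast hr1, fun n => ?_,
    eventually_norm_pow_le_of_spectralRadius_lt hr⟩
  rw [← Units.val_pow_eq_pow_val, ← Units.val_pow_eq_pow_val, ← Units.val_mul, inv_pow,
    inv_mul_cancel, Units.val_one]

end GelfandInverse

/-! ### Dominated splitting and linearized instability -/

section Dichotomy

variable {X : Type*} [NormedAddCommGroup X] [NormedSpace ℂ X] [CompleteSpace X]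

omit [CompleteSpace X] in
-- In finite dimension the spectrum of the restriction `B` of `U` consists of eigenvalues, all of
-- modulus above one.
theorem IsExpandingSubspace.exists_contracting_inverse {U : X →L[ℂ] X} {W : Submodule ℂ X}
    (hW : IsExpandingSubspace U W) :
    ∃ (B C : W →L[ℂ] W) (r : ℝ), (∀ w : W, (B w : X) = U w) ∧ 0 < r ∧ r < 1 ∧
      (∀ n : ℕ, C ^ n * B ^ n = 1) ∧ ∀ᶠ n : ℕ in Filter.atTop, ‖C ^ n‖ ≤ r ^ n := by
  have := hW.finite
  have := FiniteDimensional.complete ℂ W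
  let B : W →L[ℂ] W := (U.comp W.subtypeL).codRestrict W fun w => hW.invariant _ w.2
  have hBU : ∀ w : W, (B w : X) = U w := fun w => rfl
  obtain ⟨C, r, hC⟩ := exists_inverse_norm_pow_le (a := B) (by
    intro c hc
    rw [ContinuousLinearMap.spectrum_eq, ← Module.End.hasEigenvalue_iff_mem_spectrum] at hc
    obtain ⟨v, hv⟩ := hc.exists_hasEigenvector
    have h1 : B v = c • v := hv.apply_eq_smul
    refine hW.one_lt c v v.2 (fun h => hv.2 (Subtype.ext h)) ?_
    rw [← hBU, h1]
    rfl)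
  exact ⟨B, C, r, hBU, hC⟩

/-- If a compact operator `U` has an eigenvalue `lam` outside the closed unit disc, then some power
of `U` has a dominated splitting, given by a projection `P`, whose expanding part contains the
eigenvectors for `lam`. -/
theorem IsCompactOperator.exists_dominated_splitting {U : X →L[ℂ] X} (hU : IsCompactOperator U)
    {lam : ℂ} (hlam : 1 < ‖lam‖) {y : X} (hy : U y = lam • y) :
    ∃ (P : X →L[ℂ] X) (n : ℕ) (α β : ℝ), 0 ≤ α ∧ 4 ≤ β ∧ 4 * α ≤ β ∧ P y = y ∧
      (∀ x, β * ‖P x‖ ≤ ‖P ((U ^ n) (P x))‖) ∧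
      ∀ x, ‖(1 - P) ((U ^ n) x)‖ ≤ α * ‖(1 - P) x‖ := by
  obtain ⟨W, hW, hmax⟩ := hU.exists_maximal_isExpandingSubspace
  have := hW.finite
  obtain ⟨B, C, r, hB, hr0, hr1, hBC, e1⟩ := hW.exists_contracting_inverse
  obtain ⟨f, hf⟩ := Submodule.ClosedComplemented.of_finiteDimensional W
  obtain ⟨P, hPf⟩ : ∃ P : X →L[ℂ] X, ∀ x, P x = (f x : X) := ⟨W.subtypeL.comp f, fun _ => rfl⟩
  have hPW : ∀ x, P x ∈ W := fun x => by rw [hPf]; exact (f x).2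
  have hPid : ∀ x ∈ W, P x = x := fun x hx => by
    rw [hPf]; exact congrArg Subtype.val (hf ⟨x, hx⟩)
  obtain ⟨V, hV, hVc⟩ : ∃ V : X →L[ℂ] X, (∀ x, V x = U x - P (U x)) ∧ IsCompactOperator V := by
    refine ⟨(1 - P).comp U, fun x => by simp, ?_⟩
    rw [ContinuousLinearMap.coe_comp]
    exact hU.clm_comp (1 - P)
  -- For an eigenvector `v` of `V = (1 - P) U` with `|z| > 1`, applying `P` gives `P v = 0`, while
  -- `U v - z v = P (U v) ∈ W` forces `v ∈ W` by maximality. Hence `v = P v = 0`.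
  have hVspec : ∀ z ∈ spectrum ℂ V, ‖z‖ ≤ 1 := by
    intro z hz
    by_contra! hz1
    have hz0 : z ≠ 0 := norm_pos_iff.1 (by linarith)
    rw [← hVc.hasEigenvalue_iff_mem_spectrum hz0] at hz
    obtain ⟨v, hv⟩ := hz.exists_hasEigenvector
    have h1 : U v - P (U v) = z • v := by
      rw [← hV]; exact hv.apply_eq_smul
    have hPv : P v = 0 := by
      have h2 := congrArg P h1
      rw [map_sub, hPid _ (hPW _), sub_self, map_smul] at h2
      exact (smul_eq_zero.1 h2.symm).resolve_left hz0
    have hvW : v ∈ W := hmax v z hz1 (by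
      rw [← h1, sub_sub_cancel]; exact hPW _)
    exact hv.2 (by rw [← hPid v hvW, hPv])
  have hUW : ∀ n : ℕ, ∀ w : W, (U ^ n) w = ((B ^ n) w : X) := by
    intro n
    induction n with
    | zero => simp
    | succ n ih =>
      intro w
      rw [pow_succ', mul_apply_eq_comp, ih, ← hB, pow_succ',
        mul_apply_eq_comp]
  have hVn : ∀ n : ℕ, ∀ x, (1 - P) ((U ^ n) x) = (V ^ n) ((1 - P) x) := by
    intro n
    induction n with
    | zero => simp
    | succ n ih =>
      intro x
      rw [pow_succ', mul_apply_eq_comp, pow_succ', mul_apply_eq_comp, ← ih]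
      have h1 := hPid _ (hW.invariant _ (hPW ((U ^ n) x)))
      have h3 : ∀ w, (1 - P) w = w - P w := fun w => by simp
      rw [hV, h3, h3, map_sub, map_sub, h1]
      abel
  have hβ : 1 < r⁻¹ := (one_lt_inv₀ hr0).2 hr1
  -- With `1 < s < r⁻¹`, the complement grows at most like `s ^ n` and `W` expands at least like
  -- `r⁻¹ ^ n`; a large `n` makes the ratio at least 4.
  obtain ⟨s, hs1, hsr⟩ := exists_between hβ
  have hs0 : 0 < s := one_pos.trans hs1
  have hαβ : 1 < r⁻¹ / s := (one_lt_div hs0).2 hsr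
  have e2 := eventually_norm_pow_le_of_forall_norm_le zero_le_one hVspec hs1
  have e3 : ∀ᶠ n : ℕ in Filter.atTop, 4 ≤ r⁻¹ ^ n :=
    (tendsto_pow_atTop_atTop_of_one_lt hβ).eventually_ge_atTop 4
  have e4 : ∀ᶠ n : ℕ in Filter.atTop, 4 ≤ (r⁻¹ / s) ^ n :=
    (tendsto_pow_atTop_atTop_of_one_lt hαβ).eventually_ge_atTop 4
  obtain ⟨n, ⟨hn1, hn2⟩, hn3, hn4⟩ := ((e1.and e2).and (e3.and e4)).exists
  refine ⟨P, n, s ^ n, r⁻¹ ^ n, by positivity, hn3, ?_, ?_, ?_, ?_⟩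
  · rwa [div_pow, le_div_iff₀ (by positivity)] at hn4
  · refine hPid y (hmax y lam hlam ?_)
    simp [hy]
  · intro x
    have h1 : P ((U ^ n) (P x)) = ((B ^ n) (f x) : X) := by
      rw [hPf x, hUW]
      exact hPid _ (Subtype.prop _)
    rw [h1, inv_pow, inv_mul_le_iff₀ (by positivity)]
    have h2 : f x = (C ^ n) ((B ^ n) (f x)) := by
      rw [← mul_apply_eq_comp, hBC, one_apply_eq_self]
    rw [hPf x, Submodule.norm_coe, Submodule.norm_coe]
    conv_lhs => rw [h2]
    exact ContinuousLinearMap.le_of_opNorm_le _ hn1 _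
  · intro x
    rw [hVn]
    exact ContinuousLinearMap.le_of_opNorm_le _ hn2 _

omit [CompleteSpace X] in
-- Errors accumulated over `n` steps: since `η ≤ 1`, each step multiplies the norm by at most `‖U‖ +
-- 1`, and the `n` one-step errors are propagated by `U`.
theorem norm_sub_pow_apply_le {U : X →L[ℂ] X} {η : ℝ} (hη : 0 ≤ η) (hη1 : η ≤ 1) {x : ℕ → X}
    {i n : ℕ} (h : ∀ j < n, ‖x (i + j + 1) - U (x (i + j))‖ ≤ η * ‖x (i + j)‖) :
    ‖x (i + n)‖ ≤ (‖U‖ + 1) ^ n * ‖x i‖ ∧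
      ‖x (i + n) - (U ^ n) (x i)‖ ≤ η * (n * (‖U‖ + 1) ^ n * ‖x i‖) := by
  induction n with
  | zero => simp
  | succ n ih =>
    obtain ⟨h1, h2⟩ := ih fun j hj => h j (by omega)
    have h3 := h n (Nat.lt_succ_self n)
    have hU := U.le_opNorm (x (i + n))
    have hK : 0 ≤ (‖U‖ + 1) ^ n * ‖x i‖ := by positivity
    have hn0 := norm_nonneg (x (i + n))
    have hU0 := norm_nonneg U
    constructor
    · have h4 : ‖x (i + (n + 1))‖ ≤ ‖x (i + n + 1) - U (x (i + n))‖ + ‖U (x (i + n))‖ := by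
        simpa [add_assoc] using norm_add_le (x (i + n + 1) - U (x (i + n))) (U (x (i + n)))
      rw [pow_succ]
      nlinarith
    · have h4 : x (i + (n + 1)) - (U ^ (n + 1)) (x i) =
          (x (i + n + 1) - U (x (i + n))) + U (x (i + n) - (U ^ n) (x i)) := by
        rw [pow_succ', mul_apply_eq_comp, map_sub, add_assoc]; abel
      have h5 := U.le_opNorm (x (i + n) - (U ^ n) (x i))
      have h6 := norm_add_le (x (i + n + 1) - U (x (i + n))) (U (x (i + n) - (U ^ n) (x i)))
      rw [h4]
      have h7 : η * ‖x (i + n)‖ ≤ η * ((‖U‖ + 1) ^ (n + 1) * ‖x i‖) := by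
        refine mul_le_mul_of_nonneg_left (h1.trans ?_) hη
        rw [pow_succ]
        nlinarith
      have h8 : ‖U‖ * ‖x (i + n) - (U ^ n) (x i)‖ ≤
          (‖U‖ + 1) * (η * (n * (‖U‖ + 1) ^ n * ‖x i‖)) :=
        mul_le_mul (by linarith) h2 (norm_nonneg _) (by linarith)
      calc _ ≤ η * ((‖U‖ + 1) ^ (n + 1) * ‖x i‖) +
            (‖U‖ + 1) * (η * (n * (‖U‖ + 1) ^ n * ‖x i‖)) := by linarith
        _ = _ := by push_cast; ring

/-- Linearized instability: orbits of a map that is close to a compact operator with an eigenvalue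
outside the closed unit disc, started at a multiple of an eigenvector, leave every ball. -/
theorem IsCompactOperator.exists_forall_orbit_unbounded {U : X →L[ℂ] X}
    (hU : IsCompactOperator U) {lam : ℂ} (hlam : 1 < ‖lam‖) {y : X} (hy0 : y ≠ 0)
    (hy : U y = lam • y) :
    ∃ η > 0, ∀ c : ℂ, c ≠ 0 → ∀ C : ℝ, ∃ J : ℕ, ∀ x : ℕ → X, x 0 = c • y →
      (∀ j < J, ‖x (j + 1) - U (x j)‖ ≤ η * ‖x j‖) → C < ‖x J‖ := by
  obtain ⟨P, n, α, β, hα, hβ, hαβ, hPy, hP, hQ⟩ := hU.exists_dominated_splitting hlam hy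
  set Q : X →L[ℂ] X := 1 - P with hQdef
  set L : X →L[ℂ] X := U ^ n with hL
  have hPQ : ∀ x, P x + Q x = x := fun x => by simp [hQdef]
  -- `κ` is the aperture of the cone `‖Q z‖ ≤ κ ‖P z‖`, chosen so that the coupling `P L Q` costs at
  -- most `β / 4` on it.
  obtain ⟨κ, hκ0, hκ1, hκ⟩ : ∃ κ : ℝ, 0 < κ ∧ κ ≤ 1 ∧ ‖P.comp L‖ * κ ≤ β / 4 := by
    refine ⟨min 1 (β / 4 / (‖P.comp L‖ + 1)), by positivity, min_le_left _ _, ?_⟩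
    calc ‖P.comp L‖ * _ ≤ (‖P.comp L‖ + 1) * (β / 4 / (‖P.comp L‖ + 1)) :=
          mul_le_mul (by linarith) (min_le_right _ _) (by positivity) (by positivity)
      _ = β / 4 := by field_simp
  -- `η D` bounds both projections of the error of `n` steps; the factor 2 comes from `‖z‖ ≤ 2 ‖P
  -- z‖` in the cone, and the `+ 1` keeps `D` positive.
  set D : ℝ := n * (‖U‖ + 1) ^ n * 2 * (‖P‖ + ‖Q‖) + 1 with hD
  have hD0 : 0 < D := by positivity
  refine ⟨min 1 (κ * (β / 4) / D), by positivity, fun c hc C => ?_⟩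
  set η : ℝ := min 1 (κ * (β / 4) / D) with hη
  have hη0 : 0 ≤ η := by positivity
  have hηD : η * D ≤ κ * (β / 4) := by
    calc η * D ≤ κ * (β / 4) / D * D := mul_le_mul_of_nonneg_right (min_le_right _ _) hD0.le
      _ = _ := by field_simp
  have hcy : 0 < ‖c • y‖ := norm_pos_iff.2 (smul_ne_zero hc hy0)
  obtain ⟨i, hi⟩ := ((tendsto_pow_atTop_atTop_of_one_lt (one_lt_two (α := ℝ))).eventually_gt_atTop
    (‖P‖ * C / ‖c • y‖)).exists
  refine ⟨i * n, fun x hx0 hx => ?_⟩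
  -- Sampled every `n` steps, the orbit stays in the cone. There `‖P x‖` grows by at least `β - β /
  -- 4 - β / 4 = β / 2 ≥ 2`, while `‖Q x‖` becomes at most `κ (α + β / 4) ‖P x‖ ≤ κ (β / 2) ‖P x‖`.
  have key : ∀ m ≤ i, ‖Q (x (m * n))‖ ≤ κ * ‖P (x (m * n))‖ ∧
      2 ^ m * ‖c • y‖ ≤ ‖P (x (m * n))‖ := by
    intro m
    induction m with
    | zero =>
      intro _
      have h1 : P (x 0) = x 0 := by rw [hx0, map_smul, hPy]
      have h2 : Q (x 0) = 0 := by simp [hQdef, h1]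
      simp only [zero_mul, h1, h2]
      refine ⟨by simp; positivity, by simp [hx0]⟩
    | succ m ih =>
      intro hm
      obtain ⟨ih1, ih2⟩ := ih (by omega)
      set z := x (m * n) with hz
      set z' := x ((m + 1) * n) with hz'
      set p := ‖P z‖ with hp
      have hp0 : 0 ≤ p := norm_nonneg _
      have hzn : ‖z‖ ≤ 2 * p := by
        have h := norm_add_le (P z) (Q z)
        rw [hPQ] at h
        nlinarith
      have he : ‖z' - L z‖ ≤ η * (n * (‖U‖ + 1) ^ n * 2) * p := by
        have h := (norm_sub_pow_apply_le (U := U) (x := x) (i := m * n) (n := n) hη0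
          (min_le_left _ _) fun j hj => hx _ (by nlinarith)).2
        rw [show m * n + n = (m + 1) * n by ring] at h
        refine h.trans ?_
        rw [mul_assoc η, mul_assoc _ (2 : ℝ)]
        gcongr
      have hPe : ‖P (z' - L z)‖ + ‖Q (z' - L z)‖ ≤ κ * (β / 4) * p := by
        calc _ ≤ ‖P‖ * ‖z' - L z‖ + ‖Q‖ * ‖z' - L z‖ :=
              add_le_add (P.le_opNorm _) (Q.le_opNorm _)
          _ = (‖P‖ + ‖Q‖) * ‖z' - L z‖ := by ring
          _ ≤ (‖P‖ + ‖Q‖) * (η * (n * (‖U‖ + 1) ^ n * 2) * p) := by gcongr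
          _ = η * (D - 1) * p := by rw [hD]; ring
          _ ≤ κ * (β / 4) * p := by
            refine mul_le_mul_of_nonneg_right ?_ hp0
            nlinarith
      have hPL : ‖P (L (Q z))‖ ≤ β / 4 * p := by
        calc _ ≤ ‖P.comp L‖ * ‖Q z‖ := (P.comp L).le_opNorm _
          _ ≤ ‖P.comp L‖ * (κ * p) := by gcongr
          _ = ‖P.comp L‖ * κ * p := by ring
          _ ≤ _ := by gcongr
      have hPz' : P z' = P (L (P z)) + (P (L (Q z)) + P (z' - L z)) := by
        have : L z = L (P z) + L (Q z) := by rw [← map_add, hPQ]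
        rw [map_sub, this, map_add]; abel
      have hlow : β / 2 * p ≤ ‖P z'‖ := by
        have h1 := hP z
        have h2 : ‖P (L (P z))‖ - ‖P (L (Q z)) + P (z' - L z)‖ ≤ ‖P z'‖ := by
          have := norm_sub_le (P z') (P (L (Q z)) + P (z' - L z))
          rw [hPz', add_sub_cancel_right, ← hPz'] at this
          linarith
        have h3 := norm_add_le (P (L (Q z))) (P (z' - L z))
        have h4 := norm_nonneg (Q (z' - L z))
        have h5 : κ * (β / 4) * p ≤ β / 4 * p := by
          refine mul_le_mul_of_nonneg_right ?_ hp0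
          nlinarith
        linarith
      have hup : ‖Q z'‖ ≤ κ * (β / 2 * p) := by
        have h1 : Q z' = Q (L z) + Q (z' - L z) := by rw [← map_add]; congr 1; abel
        have h2 := norm_add_le (Q (L z)) (Q (z' - L z))
        rw [← h1] at h2
        have h3 := hQ z
        have h4 : α * ‖Q z‖ ≤ β / 4 * (κ * p) :=
          mul_le_mul (by linarith) ih1 (norm_nonneg _) (by linarith)
        have h5 := norm_nonneg (P (z' - L z))
        nlinarith
      refine ⟨hup.trans (by gcongr), ?_⟩
      rw [pow_succ]
      nlinarith
  have h1 := (key i le_rfl).2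
  rw [div_lt_iff₀ hcy] at hi
  have h2 := P.le_opNorm (x (i * n))
  exact lt_of_mul_lt_mul_left (hi.trans_le (h1.trans h2)) (norm_nonneg P)

end Dichotomy

/-! ### The linearized period map and its characteristic equation -/

section SegmentOperator

variable {V : Type*} [NormedAddCommGroup V] [NormedSpace ℂ V]

omit [NormedSpace ℂ V] in
theorem continuous_IccExtend_coe {a b : ℝ} (h : a ≤ b) (z : C(Icc a b, V)) :
    Continuous (IccExtend h z) :=
  z.continuous.Icc_extend'

omit [NormedSpace ℂ V] in
theorem norm_IccExtend_le {a b : ℝ} (h : a ≤ b) (z : C(Icc a b, V)) (s : ℝ) :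
    ‖IccExtend h z s‖ ≤ ‖z‖ :=
  z.norm_coe_le_norm _

/-- The linear operator `z ↦ M z(T) - k ∫₀ᵗ z` on continuous functions on `[0, T]`. -/
noncomputable def segmentLinearMap {T : ℝ} (hT : 0 ≤ T) (M : V →L[ℂ] V) (k : ℝ) :
    C(Icc 0 T, V) →ₗ[ℂ] C(Icc 0 T, V) where
  toFun z :=
    { toFun := fun t => M (z ⟨T, hT, le_rfl⟩) - (k : ℂ) • ∫ s in (0 : ℝ)..t, IccExtend hT z s
      continuous_toFun := by
        have h := intervalIntegral.continuous_primitive (μ := MeasureTheory.volume)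
          (fun a b => (continuous_IccExtend_coe hT z).intervalIntegrable a b) 0
        exact continuous_const.sub ((h.comp continuous_subtype_val).const_smul _) }
  map_add' z w := by
    ext t
    have h : IccExtend hT (z + w : C(Icc 0 T, V)) = fun s => IccExtend hT z s + IccExtend hT w s :=
      rfl
    have hi := intervalIntegral.integral_add (μ := MeasureTheory.volume)
      ((continuous_IccExtend_coe hT z).intervalIntegrable 0 t)
      ((continuous_IccExtend_coe hT w).intervalIntegrable 0 t)
    simp only [ContinuousMap.coe_mk, ContinuousMap.add_apply, h, hi, map_add, smul_add]
    abel
  map_smul' c z := by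
    ext t
    have h : IccExtend hT (c • z : C(Icc 0 T, V)) = fun s => c • IccExtend hT z s := rfl
    simp only [ContinuousMap.coe_mk, ContinuousMap.smul_apply, h, map_smul,
      intervalIntegral.integral_smul, RingHom.id_apply, smul_sub]
    rw [smul_comm]

theorem segmentLinearMap_apply {T : ℝ} (hT : 0 ≤ T) (M : V →L[ℂ] V) (k : ℝ) (z : C(Icc 0 T, V))
    (t : Icc 0 T) : segmentLinearMap hT M k z t =
      M (z ⟨T, hT, le_rfl⟩) - (k : ℂ) • ∫ s in (0 : ℝ)..t, IccExtend hT z s := rfl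

/-- The term `M z(T)` does not depend on `t`, so only the integral varies. This is the
equicontinuity behind compactness. -/
theorem dist_segmentLinearMap_apply_le {T : ℝ} (hT : 0 ≤ T) (M : V →L[ℂ] V) (k : ℝ)
    (z : C(Icc 0 T, V)) (s t : Icc 0 T) :
    dist (segmentLinearMap hT M k z s) (segmentLinearMap hT M k z t) ≤ |k| * ‖z‖ * dist s t := by
  have hi := fun a b => (continuous_IccExtend_coe hT z).intervalIntegrable
    (μ := MeasureTheory.volume) a b
  rw [segmentLinearMap_apply, segmentLinearMap_apply, dist_sub_left, dist_eq_norm, ← smul_sub,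
    intervalIntegral.integral_interval_sub_left (hi _ _) (hi _ _), norm_smul, Complex.norm_real,
    Real.norm_eq_abs, mul_assoc]
  refine mul_le_mul_of_nonneg_left ?_ (abs_nonneg k)
  exact intervalIntegral.norm_integral_le_of_norm_le_const fun r _ => norm_IccExtend_le hT z r

theorem norm_segmentLinearMap_apply_le {T : ℝ} (hT : 0 ≤ T) (M : V →L[ℂ] V) (k : ℝ)
    (z : C(Icc 0 T, V)) (t : Icc 0 T) :
    ‖segmentLinearMap hT M k z t‖ ≤ (‖M‖ + |k| * T) * ‖z‖ := by
  have h0 : segmentLinearMap hT M k z ⟨0, le_rfl, hT⟩ = M (z ⟨T, hT, le_rfl⟩) := by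
    simp [segmentLinearMap_apply]
  have h1 := dist_segmentLinearMap_apply_le hT M k z t ⟨0, le_rfl, hT⟩
  rw [h0, dist_eq_norm] at h1
  have h2 : dist t ⟨0, le_rfl, hT⟩ ≤ T := by
    rw [Subtype.dist_eq, Real.dist_eq, sub_zero, abs_of_nonneg t.2.1]; exact t.2.2
  have h3 : ‖M (z ⟨T, hT, le_rfl⟩)‖ ≤ ‖M‖ * ‖z‖ := M.le_opNorm_of_le (z.norm_coe_le_norm _)
  have h4 := norm_sub_norm_le (segmentLinearMap hT M k z t) (M (z ⟨T, hT, le_rfl⟩))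
  have h5 : |k| * ‖z‖ * dist t ⟨0, le_rfl, hT⟩ ≤ |k| * ‖z‖ * T := by gcongr
  nlinarith

/-- `segmentLinearMap` as a continuous linear map. -/
noncomputable def segmentOperator {T : ℝ} (hT : 0 ≤ T) (M : V →L[ℂ] V) (k : ℝ) :
    C(Icc 0 T, V) →L[ℂ] C(Icc 0 T, V) :=
  (segmentLinearMap hT M k).mkContinuous (‖M‖ + |k| * T) fun z =>
    (ContinuousMap.norm_le _ (by positivity)).2 fun t => norm_segmentLinearMap_apply_le hT M k z t

theorem segmentOperator_apply {T : ℝ} (hT : 0 ≤ T) (M : V →L[ℂ] V) (k : ℝ) (z : C(Icc 0 T, V))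
    (t : Icc 0 T) : segmentOperator hT M k z t =
      M (z ⟨T, hT, le_rfl⟩) - (k : ℂ) • ∫ s in (0 : ℝ)..t, IccExtend hT z s := rfl

theorem isCompactOperator_segmentOperator [FiniteDimensional ℂ V] {T : ℝ} (hT : 0 ≤ T)
    (M : V →L[ℂ] V) (k : ℝ) : IsCompactOperator (segmentOperator hT M k) := by
  have : ProperSpace V := FiniteDimensional.proper ℂ V
  let S : Set C(Icc 0 T, V) := {w | (∀ t, w t ∈ Metric.closedBall (0 : V) (‖M‖ + |k| * T)) ∧
    ∀ s t, dist (w s) (w t) ≤ |k| * dist s t}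
  have hLip : ∀ w ∈ S, LipschitzWith |k|.toNNReal w := fun w hw =>
    LipschitzWith.of_dist_le_mul fun s t => by
      rw [Real.coe_toNNReal _ (abs_nonneg k)]; exact hw.2 s t
  have hS : IsCompact S := by
    refine ArzelaAscoli.isCompact_of_equicontinuous S ?_ ?_
    -- Being Lipschitz is closed under pointwise convergence and implies continuity, so the image is
    -- a closed subset of a product of compact balls.
    · have himg : ContinuousMap.toFun '' S =
          (univ.pi fun _ : Icc 0 T => Metric.closedBall (0 : V) (‖M‖ + |k| * T)) ∩
            {w | ∀ s t, dist (w s) (w t) ≤ |k| * dist s t} := by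
        ext w
        constructor
        · rintro ⟨w, hw, rfl⟩
          exact ⟨fun t _ => hw.1 t, hw.2⟩
        · rintro ⟨h1, h2⟩
          have hc : Continuous w := (LipschitzWith.of_dist_le_mul (K := |k|.toNNReal)
            fun s t => by rw [Real.coe_toNNReal _ (abs_nonneg k)]; exact h2 s t).continuous
          exact ⟨⟨w, hc⟩, ⟨fun t => h1 t (mem_univ t), h2⟩, rfl⟩
      rw [himg]
      refine (isCompact_univ_pi fun _ => isCompact_closedBall _ _).inter_right ?_
      simp only [ofPred_forall]
      exact isClosed_iInter fun s => isClosed_iInter fun t =>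
        isClosed_le ((continuous_apply s).dist (continuous_apply t)) continuous_const
    · exact (LipschitzWith.uniformEquicontinuous _ |k|.toNNReal
        fun w : S => hLip w w.2).equicontinuous
  refine (isCompactOperator_iff_image_closedBall_subset_compact
    (segmentOperator hT M k).toLinearMap one_pos).2 ⟨S, hS, ?_⟩
  rintro _ ⟨z, hz, rfl⟩
  rw [mem_closedBall_zero_iff] at hz
  refine ⟨fun t => ?_, fun s t => ?_⟩
  · rw [mem_closedBall_zero_iff]
    exact (norm_segmentLinearMap_apply_le hT M k z t).trans
      (mul_le_of_le_one_right (by positivity) hz)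
  · refine (dist_segmentLinearMap_apply_le hT M k z s t).trans ?_
    exact mul_le_mul_of_nonneg_right (mul_le_of_le_one_right (abs_nonneg k) hz) dist_nonneg

/-- The function `t ↦ exp(-k t / lam) v` on `[0, T]`. -/
noncomputable def expSegment (T k lam : ℝ) (v : V) : C(Icc 0 T, V) where
  toFun t := ((Real.exp (-(k / lam) * t) : ℝ) : ℂ) • v

/-- Since `k ∫₀ᵗ exp(-k s / lam) ds = lam - lam exp(-k t / lam)`, the characteristic equation `hm`
cancels the constant terms. -/
theorem segmentOperator_expSegment [CompleteSpace V] {T : ℝ} (hT : 0 ≤ T) {M : V →L[ℂ] V} {k lam m : ℝ}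
    (hlam : lam ≠ 0) (hm : m * Real.exp (-(k / lam) * T) = lam) {v : V} (hv : M v = (m : ℂ) • v) :
    segmentOperator hT M k (expSegment T k lam v) = (lam : ℂ) • expSegment T k lam v := by
  ext t
  have hint : (k : ℂ) • ∫ s in (0 : ℝ)..t, IccExtend hT (expSegment T k lam v) s =
      ((lam - lam * Real.exp (-(k / lam) * t) : ℝ) : ℂ) • v := by
    have hd : ∀ s ∈ uIcc (0 : ℝ) t, HasDerivAt
        (fun s : ℝ => ((lam - lam * Real.exp (-(k / lam) * s) : ℝ) : ℂ) • v)
        ((k : ℂ) • (((Real.exp (-(k / lam) * s) : ℝ) : ℂ) • v)) s := by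
      intro s _
      have h1 : HasDerivAt (fun s : ℝ => lam - lam * Real.exp (-(k / lam) * s))
          (k * Real.exp (-(k / lam) * s)) s := by
        have h2 : HasDerivAt (fun s : ℝ => -(k / lam) * s) (-(k / lam) * 1) s :=
          (hasDerivAt_id s).const_mul _
        refine ((h2.exp.const_mul lam).const_sub lam).congr_deriv ?_
        field_simp
      refine (h1.ofReal_comp.smul_const v).congr_deriv ?_
      rw [smul_smul]; push_cast; rfl
    have hcong : ∫ s in (0 : ℝ)..t, IccExtend hT (expSegment T k lam v) s =
        ∫ s in (0 : ℝ)..t, ((Real.exp (-(k / lam) * s) : ℝ) : ℂ) • v := by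
      refine intervalIntegral.integral_congr fun s hs => ?_
      rw [uIcc_of_le t.2.1] at hs
      exact IccExtend_of_mem hT _ ⟨hs.1, hs.2.trans t.2.2⟩
    rw [hcong, ← intervalIntegral.integral_smul, intervalIntegral.integral_eq_sub_of_hasDerivAt hd
      (Continuous.intervalIntegrable (by fun_prop) _ _)]
    simp
  rw [segmentOperator_apply, hint]
  simp only [expSegment, ContinuousMap.coe_mk, ContinuousMap.smul_apply, map_smul, hv, smul_smul,
    ← sub_smul, ← Complex.ofReal_mul, ← Complex.ofReal_sub]
  congr 2
  linear_combination hm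

end SegmentOperator

/-- For `μ > 1` the characteristic equation `lam = μ exp(κ (1 - 1 / lam))` has a root above one. -/
theorem exists_one_lt_root_characteristic {μ : ℝ} (hμ : 1 < μ) (κ : ℝ) :
    ∃ lam : ℝ, 1 < lam ∧ μ * Real.exp (κ * (1 - 1 / lam)) = lam := by
  let g : ℝ → ℝ := fun x => μ * Real.exp (κ * (1 - 1 / x)) - x
  -- `b` exceeds `μ exp(κ (1 - 1 / x))` for all `x ≥ 1`, so `g b ≤ 0`; and `g 1 = μ - 1 > 0` also
  -- keeps the root away from 1.
  set b := μ * Real.exp |κ| + 1 with hb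
  have hE : 1 ≤ Real.exp |κ| := Real.one_le_exp (abs_nonneg κ)
  have hb1 : 1 ≤ b := by nlinarith
  have hg : ContinuousOn g (Icc 1 b) := by
    have : ContinuousOn (fun x : ℝ => 1 / x) (Icc 1 b) :=
      continuousOn_const.div continuousOn_id fun x hx => by
        have := hx.1
        linarith
    fun_prop
  have hgb : g b ≤ 0 := by
    have h0 : 0 ≤ 1 - 1 / b := by
      rw [sub_nonneg, div_le_one (by linarith)]; exact hb1
    have h1 : 1 - 1 / b ≤ 1 := by
      have : 0 ≤ 1 / b := by positivity
      linarith
    have h2 : κ * (1 - 1 / b) ≤ |κ| :=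
      (mul_le_mul_of_nonneg_right (le_abs_self κ) h0).trans
        (mul_le_of_le_one_right (abs_nonneg κ) h1)
    have h3 := mul_le_mul_of_nonneg_left (Real.exp_le_exp.2 h2) (by linarith : (0 : ℝ) ≤ μ)
    simp only [g]
    linarith
  have hg1 : 0 ≤ g 1 := by simp [g]; linarith
  obtain ⟨x, hx, hx0⟩ := intermediate_value_Icc' hb1 hg ⟨hgb, hg1⟩
  refine ⟨x, lt_of_le_of_ne hx.1 ?_, by simp only [g] at hx0; linarith⟩
  rintro rfl
  simp [g] at hx0
  linarith

/-! ### Clamping, linear ODEs, existence, gluing and linearization -/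

section RadialClamp

variable {E : Type*} [NormedAddCommGroup E] [NormedSpace ℝ E]

/-- The radial retraction onto the closed ball of radius `r` around the origin. -/
noncomputable def radialClamp (r : ℝ) (u : E) : E := (r / max r ‖u‖) • u

theorem radialClamp_of_norm_le {r : ℝ} (hr : 0 < r) {u : E} (hu : ‖u‖ ≤ r) :
    radialClamp r u = u := by
  rw [radialClamp, max_eq_left hu, div_self hr.ne', one_smul]

theorem norm_radialClamp_le {r : ℝ} (hr : 0 < r) (u : E) : ‖radialClamp r u‖ ≤ r := by
  have h : 0 < max r ‖u‖ := lt_max_of_lt_left hr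
  rw [radialClamp, norm_smul, Real.norm_of_nonneg (by positivity), div_mul_eq_mul_div,
    div_le_iff₀ h]
  exact mul_le_mul_of_nonneg_left (le_max_right _ _) hr.le

/-- One unit of the constant comes from `u - v` scaled by at most 1, the other from the change of
the scaling factor. -/
theorem lipschitzWith_radialClamp {r : ℝ} (hr : 0 < r) :
    LipschitzWith 2 (radialClamp r : E → E) := by
  refine LipschitzWith.of_dist_le_mul fun u v => ?_
  rw [dist_eq_norm, dist_eq_norm]
  set a := max r ‖u‖ with ha
  set b := max r ‖v‖ with hb
  have ha0 : 0 < a := lt_max_of_lt_left hr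
  have hb0 : 0 < b := lt_max_of_lt_left hr
  have hra : r / a ≤ 1 := (div_le_one ha0).2 (le_max_left _ _)
  have hab : |b - a| ≤ ‖u - v‖ := by
    rw [hb, ha, max_comm r, max_comm r]
    refine (abs_max_sub_max_le_abs _ _ _).trans ?_
    rw [norm_sub_rev]
    exact abs_norm_sub_norm_le v u
  have hsplit : radialClamp r u - radialClamp r v =
      (r / a) • (u - v) + (r / a * ((b - a) / b)) • v := by
    have h : r / b = r / a - r / a * ((b - a) / b) := by field_simp; ring
    rw [radialClamp, radialClamp, ← ha, ← hb, h]
    module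
  have hvb : |b - a| / b * ‖v‖ ≤ |b - a| := by
    rw [div_mul_eq_mul_div, div_le_iff₀ hb0]
    exact mul_le_mul_of_nonneg_left (le_max_right _ _) (abs_nonneg _)
  have h0 : 0 ≤ r / a := by positivity
  rw [hsplit]
  refine (norm_add_le _ _).trans ?_
  rw [norm_smul, norm_smul, norm_mul, Real.norm_of_nonneg h0, norm_div, Real.norm_of_nonneg hb0.le,
    Real.norm_eq_abs, mul_assoc]
  have h1 := mul_le_mul hra hvb (by positivity) zero_le_one
  have h2 := mul_le_mul_of_nonneg_right hra (norm_nonneg (u - v))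
  simp only [NNReal.coe_ofNat]
  linarith

end RadialClamp

section LinearODE

variable {E : Type*} [NormedAddCommGroup E] [NormedSpace ℝ E]

/-- A solution of a linear ODE that vanishes at some time vanished at all earlier times. -/
theorem eq_zero_of_linear_ode_of_eq_zero_right {A : ℝ → (E →L[ℝ] E)} (hA : Continuous A)
    {w : ℝ → E} {b : ℝ} (hw : ∀ t ∈ Icc 0 b, HasDerivWithinAt w (A t (w t)) (Icc 0 b) t)
    (hb : w b = 0) : ∀ t ∈ Icc 0 b, w t = 0 := by
  obtain ⟨K, hK⟩ := (isCompact_Icc (a := (0 : ℝ)) (b := b)).exists_bound_of_continuousOn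
    hA.continuousOn
  refine ODE_solution_unique_of_mem_Icc_left (v := fun t x => A t x) (s := fun _ => univ)
    (K := K.toNNReal) (g := fun _ => 0) ?_ (fun t ht => (hw t ht).continuousWithinAt) ?_
    (fun _ _ => mem_univ _) continuousOn_const ?_ (fun _ _ => mem_univ _) hb
  · intro t ht
    refine ((A t).lipschitz.weaken ?_).lipschitzOnWith
    rw [← NNReal.coe_le_coe, coe_nnnorm]
    exact (hK t ⟨ht.1.le, ht.2⟩).trans (Real.le_coe_toNNReal K)
  · intro t ht
    exact (hw t ⟨ht.1.le, ht.2⟩).mono_of_mem_nhdsWithin (Icc_mem_nhdsLE_of_mem ht)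
  · intro t _
    simpa using hasDerivWithinAt_const t (Iic t) (0 : E)

/-- A fundamental solution of a linear ODE is invertible, and the inverse solves the adjoint
equation. -/
theorem exists_inverse_fundamental_solution [FiniteDimensional ℝ E] {A Y : ℝ → (E →L[ℝ] E)}
    (hA : Continuous A) (hY0 : Y 0 = 1)
    (hY : ∀ t ∈ Ici (0 : ℝ), HasDerivWithinAt Y ((A t).comp (Y t)) (Ici 0) t) :
    ∃ Z : ℝ → (E →L[ℝ] E), (∀ t, 0 ≤ t → Z t * Y t = 1 ∧ Y t * Z t = 1) ∧
      ∀ t, 0 ≤ t → HasDerivWithinAt Z (-(Z t * A t)) (Ici 0) t := by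
  have := FiniteDimensional.complete ℝ E
  have hunit : ∀ t, 0 ≤ t → IsUnit (Y t) := by
    intro t ht
    rw [ContinuousLinearMap.isUnit_iff_bijective]
    have hinj : Function.Injective (Y t : E →ₗ[ℝ] E) := by
      rw [← LinearMap.ker_eq_bot, LinearMap.ker_eq_bot']
      intro v hv
      -- A kernel vector `v` of `Y t` gives a solution `Y s v` vanishing at `t`, hence at `0`, where
      -- it equals `v`.
      have := eq_zero_of_linear_ode_of_eq_zero_right hA (w := fun s => Y s v) (b := t)
        (fun s hs => by
          simpa using! ((hY s hs.1).mono Icc_subset_Ici_self).clm_apply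
            (hasDerivWithinAt_const s (Icc 0 t) v)) hv 0 ⟨le_rfl, ht⟩
      simpa [hY0] using this
    exact ⟨hinj, LinearMap.injective_iff_surjective.1 hinj⟩
  refine ⟨fun t => Ring.inverse (Y t), fun t ht =>
    ⟨Ring.inverse_mul_cancel _ (hunit t ht), Ring.mul_inverse_cancel _ (hunit t ht)⟩,
    fun t ht => ?_⟩
  obtain ⟨u, hu⟩ := hunit t ht
  have h1 := hasFDerivAt_ringInverse (𝕜 := ℝ) u
  rw [hu] at h1
  refine (h1.comp_hasDerivWithinAt t (hY t ht)).congr_deriv ?_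
  have h2 : Ring.inverse (Y t) = ((u⁻¹ : (E →L[ℝ] E)ˣ) : E →L[ℝ] E) := by
    rw [← hu, Ring.inverse_unit]
  have h3 : (A t).comp (Y t) = A t * (u : E →L[ℝ] E) := by rw [hu]; rfl
  rw [h3]
  simp only [h2, neg_apply, ContinuousLinearMap.mulLeftRight_apply]
  rw [mul_assoc, mul_assoc, Units.mul_inv, mul_one]

end LinearODE

section Existence

variable {E : Type*} [NormedAddCommGroup E] [NormedSpace ℝ E] [CompleteSpace E]

/-- A bounded Lipschitz vector field has integral curves on every compact interval. -/
theorem exists_solution_of_bounded_lipschitz {F : ℝ → E → E} {T : ℝ} (hT : 0 ≤ T) {K : NNReal}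
    {L : ℝ} (hK : ∀ t ∈ Icc 0 T, LipschitzWith K (F t)) (hL : ∀ t ∈ Icc 0 T, ∀ x, ‖F t x‖ ≤ L)
    (hF : ∀ x, ContinuousOn (F · x) (Icc 0 T)) (x₀ : E) :
    ∃ u : ℝ → E, u 0 = x₀ ∧ ∀ t ∈ Icc 0 T, HasDerivWithinAt u (F t (u t)) (Icc 0 T) t := by
  -- A field bounded by `L` cannot leave the ball of radius `L T` within time `T`, so one
  -- Picard–Lindelöf step covers the whole interval.
  have h : IsPicardLindelof F (⟨0, le_rfl, hT⟩ : Icc 0 T) x₀ (L.toNNReal * T.toNNReal) 0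
      L.toNNReal K :=
    { lipschitzOnWith := fun t ht => (hK t ht).lipschitzOnWith
      continuousOn := fun x _ => hF x
      norm_le := fun t ht x _ => (hL t ht x).trans (Real.le_coe_toNNReal L)
      mul_max_le := by simp [hT] }
  exact h.exists_eq_forall_mem_Icc_hasDerivWithinAt₀

end Existence

section Glue

variable {E : Type*} [NormedAddCommGroup E] [NormedSpace ℝ E]

theorem hasDerivWithinAt_Icc_append {w : ℝ → E} {w' : E} {a b c t : ℝ} (hab : a ≤ b) (hbc : b ≤ c)
    (h1 : t ∈ Icc a b → HasDerivWithinAt w w' (Icc a b) t)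
    (h2 : t ∈ Icc b c → HasDerivWithinAt w w' (Icc b c) t) (ht : t ∈ Icc a c) :
    HasDerivWithinAt w w' (Icc a c) t := by
  rcases lt_trichotomy t b with h | h | h
  · refine (h1 ⟨ht.1, h.le⟩).mono_of_mem_nhdsWithin ?_
    filter_upwards [self_mem_nhdsWithin, mem_nhdsWithin_of_mem_nhds (Iio_mem_nhds h)] with x hx hx'
    exact ⟨hx.1, le_of_lt hx'⟩
  · rw [← Icc_union_Icc_eq_Icc hab hbc]
    exact (h1 ⟨ht.1, h.le⟩).union (h2 ⟨h.ge, ht.2⟩)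
  · refine (h2 ⟨h.le, ht.2⟩).mono_of_mem_nhdsWithin ?_
    filter_upwards [self_mem_nhdsWithin, mem_nhdsWithin_of_mem_nhds (Ioi_mem_nhds h)] with x hx hx'
    exact ⟨le_of_lt hx', hx.2⟩

theorem hasDerivWithinAt_Icc_of_segments {w w' : ℝ → E} {T : ℝ} (hT : 0 ≤ T)
    (h : ∀ j : ℕ, ∀ t ∈ Icc (j * T) ((j + 1) * T),
      HasDerivWithinAt w (w' t) (Icc (j * T) ((j + 1) * T)) t) (n : ℕ) :
    ∀ t ∈ Icc 0 (n * T), HasDerivWithinAt w (w' t) (Icc 0 (n * T)) t := by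
  induction n with
  | zero =>
    intro t ht
    simp only [Nat.cast_zero, zero_mul, Icc_self, mem_singleton_iff] at ht ⊢
    rw [ht]
    exact HasFDerivWithinAt.of_subsingleton subsingleton_singleton
  | succ n ih =>
    intro t ht
    push_cast at ht ⊢
    exact hasDerivWithinAt_Icc_append (by positivity) (by nlinarith) (ih t) (h n t) ht

end Glue

section Linearization

variable {E : Type*} [NormedAddCommGroup E] [NormedSpace ℝ E] {f : E → ℝ → E}

theorem hasFDerivAt_fst_slice (hf : ContDiff ℝ 1 (fun p : E × ℝ => f p.1 p.2)) (x : E) (t : ℝ) :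
    HasFDerivAt (fun z => f z t) ((fderiv ℝ (fun p : E × ℝ => f p.1 p.2) (x, t)).comp
      (ContinuousLinearMap.inl ℝ E ℝ)) x :=
  HasFDerivAt.comp (g := fun p : E × ℝ => f p.1 p.2) x
    (hf.differentiable one_ne_zero (x, t)).hasFDerivAt (hasFDerivAt_prodMk_left (𝕜 := ℝ) x t)

theorem continuous_fderiv_fst_slice (hf : ContDiff ℝ 1 (fun p : E × ℝ => f p.1 p.2)) :
    Continuous fun p : E × ℝ => fderiv ℝ (fun z => f z p.2) p.1 := by
  have h : (fun p : E × ℝ => fderiv ℝ (fun z => f z p.2) p.1) = fun p =>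
      (fderiv ℝ (fun p : E × ℝ => f p.1 p.2) p).comp (ContinuousLinearMap.inl ℝ E ℝ) := by
    ext1 p
    exact (hasFDerivAt_fst_slice hf p.1 p.2).fderiv
  rw [h]
  exact (hf.continuous_fderiv one_ne_zero).clm_comp continuous_const

/-- Linearization along a curve, uniformly on compact time intervals. -/
theorem exists_radius_norm_sub_fderiv_le (hf : ContDiff ℝ 1 (fun p : E × ℝ => f p.1 p.2))
    {xs : ℝ → E} (hxs : Continuous xs) (T : ℝ) {η : ℝ} (hη : 0 < η) :
    ∃ r > 0, ∀ t ∈ Icc 0 T, ∀ u v : E, ‖u‖ ≤ r → ‖v‖ ≤ r →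
      ‖f (xs t + u) t - f (xs t + v) t - fderiv ℝ (fun z => f z t) (xs t) (u - v)‖ ≤
        η * ‖u - v‖ := by
  set D : E × ℝ → (E →L[ℝ] E) := fun p => fderiv ℝ (fun z => f z p.2) p.1 with hD
  have hDc : Continuous D := continuous_fderiv_fst_slice hf
  have hev : ∀ᶠ u in nhds (0 : E), ∀ t ∈ Icc 0 T, ‖D (xs t + u, t) - D (xs t, t)‖ < η := by
    refine isCompact_Icc.eventually_forall_of_forall_eventually fun t _ => ?_
    have hc : Continuous fun q : E × ℝ => ‖D (xs q.2 + q.1, q.2) - D (xs q.2, q.2)‖ := by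
      fun_prop
    exact hc.continuousAt.eventually_lt_const (by simpa using hη)
  obtain ⟨ρ, hρ, hball⟩ := Metric.eventually_nhds_iff_ball.1 hev
  refine ⟨ρ / 2, by positivity, fun t ht u v hu hv => ?_⟩
  have hconv : Convex ℝ (Metric.closedBall (xs t) (ρ / 2)) := convex_closedBall _ _
  have hmem : ∀ w : E, ‖w‖ ≤ ρ / 2 → xs t + w ∈ Metric.closedBall (xs t) (ρ / 2) := by
    intro w hw
    rw [mem_closedBall_iff_norm]; simpa using hw
  have hmv := hconv.norm_image_sub_le_of_norm_hasFDerivWithin_le' (f := fun z => f z t)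
    (f' := fun z => D (z, t)) (φ := D (xs t, t)) (C := η)
    (fun z _ => ((hasFDerivAt_fst_slice hf z t).differentiableAt.hasFDerivAt).hasFDerivWithinAt)
    (fun z hz => by
      have := hball (z - xs t) (by
        rw [mem_ball_zero_iff]; rw [mem_closedBall_iff_norm] at hz; linarith) t ht
      rw [add_sub_cancel] at this
      exact this.le) (hmem v hv) (hmem u hu)
  rw [add_sub_add_left_eq_sub] at hmv
  exact hmv

end Linearization

section Segments

variable {E : Type*}

/-- Concatenation of functions `u j` on `[0, T]` to a function on `[-T, ∞)`. -/
noncomputable def concatSegments (T : ℝ) (u : ℕ → ℝ → E) (t : ℝ) : E :=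
  u (⌊t / T⌋ + 1).toNat (t - ⌊t / T⌋ * T)

/-- Segment `j` lives on `[jT - T, jT]`, so that segment 0 is the history on `[-T, 0]`. At `τ = T`
the floor already selects segment `j + 1`, and the matching condition `hu` is needed. -/
theorem concatSegments_add {T : ℝ} (hT : 0 < T) {u : ℕ → ℝ → E} (hu : ∀ j, u (j + 1) 0 = u j T)
    (j : ℕ) {τ : ℝ} (hτ : τ ∈ Icc 0 T) : concatSegments T u (j * T - T + τ) = u j τ := by
  rcases hτ.2.lt_or_eq with h | rfl
  · have hfl : ⌊(j * T - T + τ) / T⌋ = (j : ℤ) - 1 := by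
      rw [Int.floor_eq_iff]
      push_cast
      rw [le_div_iff₀ hT, div_lt_iff₀ hT]
      constructor <;> nlinarith [hτ.1]
    rw [concatSegments, hfl, sub_add_cancel, Int.toNat_natCast]
    push_cast
    congr 1
    ring
  · have hfl : ⌊(j * τ - τ + τ) / τ⌋ = (j : ℤ) := by
      rw [sub_add_cancel, mul_div_cancel_right₀ _ hT.ne', Int.floor_natCast]
    have h1 : ((j : ℤ) + 1).toNat = j + 1 := by omega
    rw [concatSegments, hfl, h1, ← hu]
    push_cast
    congr 1
    ring

theorem exists_nat_segment {T : ℝ} (hT : 0 < T) {s : ℝ} : ∃ n : ℕ, s ≤ n * T := by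
  obtain ⟨n, hn⟩ := exists_nat_ge (s / T)
  exact ⟨n, (div_le_iff₀ hT).1 hn⟩

end Segments

/-! ### The deviation equation and its clamped version -/

section Controlled

variable {N : ℕ} {f : State N → ℝ → State N} {T : ℝ} {xs : ℝ → State N}

theorem IsPeriodicSolution.continuous (h : IsPeriodicSolution f T xs) : Continuous xs :=
  continuous_iff_continuousAt.2 fun t => (h.2 t).continuousAt

/-- Right-hand side of the equation for the deviation `w` from `xs`, with the argument of the
vector field clamped to the ball of radius `r`. -/
noncomputable def clampedField (f : State N → ℝ → State N) (xs : ℝ → State N) (k r t : ℝ)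
    (x y : State N) : State N :=
  f (xs t + radialClamp r x) t - f (xs t) t + k • radialClamp r x - k • y

theorem clampedField_sub_mul (hfT : ∀ (x : State N) (t : ℝ), f x (t + T) = f x t)
    (hxs : Function.Periodic xs T) (k r t : ℝ) (x y : State N) (n : ℕ) :
    clampedField f xs k r (t - n * T) x y = clampedField f xs k r t x y := by
  have h1 : xs (t - n * T) = xs t := hxs.sub_nat_mul_eq n
  have h2 : ∀ z, f z (t - n * T) = f z t := fun z =>
    (show Function.Periodic (f z) T from hfT z).sub_nat_mul_eq n
  simp only [clampedField, h1, h2]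

/-- Method of steps: the delayed term is a known function `g`, which leaves an ODE. Clamping makes
its field bounded and globally Lipschitz; `hlin` serves only as a Lipschitz estimate here. -/
theorem exists_clamped_segment (hf : ContDiff ℝ 1 (fun p : State N × ℝ => f p.1 p.2))
    (hT : 0 < T) (hxs : Continuous xs) (k : ℝ) {r : ℝ} (hr : 0 < r)
    (hlin : ∀ t ∈ Icc 0 T, ∀ u v : State N, ‖u‖ ≤ r → ‖v‖ ≤ r →
      ‖f (xs t + u) t - f (xs t + v) t - linearization f xs t (u - v)‖ ≤ 1 * ‖u - v‖)
    {g : ℝ → State N} (hg : ContinuousOn g (Icc 0 T)) (x₀ : State N) :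
    ∃ u : ℝ → State N, u 0 = x₀ ∧ ∀ t ∈ Icc 0 T,
      HasDerivWithinAt u (clampedField f xs k r t (u t) (g t)) (Icc 0 T) t := by
  have hAc : Continuous (linearization f xs) :=
    (continuous_fderiv_fst_slice hf).comp (hxs.prodMk continuous_id)
  obtain ⟨a, ha⟩ := isCompact_Icc.exists_bound_of_continuousOn (hAc.continuousOn (s := Icc 0 T))
  obtain ⟨b, hb⟩ := isCompact_Icc.exists_bound_of_continuousOn hg
  have ha0 : 0 ≤ a := (norm_nonneg _).trans (ha 0 ⟨le_rfl, hT.le⟩)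
  have hdist : ∀ t ∈ Icc 0 T, ∀ u v : State N, ‖u‖ ≤ r → ‖v‖ ≤ r →
      ‖f (xs t + u) t - f (xs t + v) t‖ ≤ (a + 1) * ‖u - v‖ := by
    intro t ht u v hu hv
    have h1 := hlin t ht u v hu hv
    have h2 := (linearization f xs t).le_of_opNorm_le (ha t ht) (u - v)
    have h3 := norm_sub_norm_le (f (xs t + u) t - f (xs t + v) t) (linearization f xs t (u - v))
    linarith
  have hfc : Continuous fun p : State N × ℝ => f p.1 p.2 := hf.continuous
  refine exists_solution_of_bounded_lipschitz (F := fun t x => clampedField f xs k r t x (g t))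
    hT.le (K := ((a + 1 + |k|) * 2).toNNReal)
    (L := (a + 1) * r + |k| * r + |k| * b) ?_ ?_ ?_ x₀
  · intro t ht
    refine LipschitzWith.of_dist_le_mul fun x y => ?_
    rw [Real.coe_toNNReal _ (by positivity), dist_eq_norm]
    have hx := norm_radialClamp_le hr x
    have hy := norm_radialClamp_le hr y
    have h1 := hdist t ht _ _ hx hy
    have h2 := (lipschitzWith_radialClamp hr).dist_le_mul x y
    rw [dist_eq_norm] at h2
    have hsub : clampedField f xs k r t x (g t) - clampedField f xs k r t y (g t) =
        (f (xs t + radialClamp r x) t - f (xs t + radialClamp r y) t) +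
          k • (radialClamp r x - radialClamp r y) := by
      simp only [clampedField]; module
    have h3 := norm_add_le (f (xs t + radialClamp r x) t - f (xs t + radialClamp r y) t)
      (k • (radialClamp r x - radialClamp r y))
    rw [← hsub, norm_smul, Real.norm_eq_abs] at h3
    have h4 : (a + 1 + |k|) * ‖radialClamp r x - radialClamp r y‖ ≤
        (a + 1 + |k|) * (2 * dist x y) := mul_le_mul_of_nonneg_left h2 (by positivity)
    linarith
  · intro t ht x
    have hx := norm_radialClamp_le hr x
    have h1 := hdist t ht _ 0 hx (by simpa using hr.le)
    rw [add_zero, sub_zero] at h1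
    have h2 : ‖k • radialClamp r x‖ ≤ |k| * r := by
      rw [norm_smul, Real.norm_eq_abs]; gcongr
    have h3 : ‖k • g t‖ ≤ |k| * b := by
      rw [norm_smul, Real.norm_eq_abs]; gcongr; exact hb t ht
    have h4 : (a + 1) * ‖radialClamp r x‖ ≤ (a + 1) * r := by gcongr
    have h5 := norm_sub_le (f (xs t + radialClamp r x) t - f (xs t) t + k • radialClamp r x)
      (k • g t)
    have h6 := norm_add_le (f (xs t + radialClamp r x) t - f (xs t) t) (k • radialClamp r x)
    simp only [clampedField]
    linarith
  · intro x
    have h1 : Continuous fun t => f (xs t + radialClamp r x) t :=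
      hfc.comp ((hxs.add continuous_const).prodMk continuous_id)
    have h2 : Continuous fun t => f (xs t) t := hfc.comp (hxs.prodMk continuous_id)
    exact ((h1.sub h2).add continuous_const).continuousOn.sub (hg.const_smul k)

/-- Global existence for the deviation equation with clamped vector field. -/
theorem exists_clamped_solution (hf : ContDiff ℝ 1 (fun p : State N × ℝ => f p.1 p.2))
    (hT : 0 < T) (hfT : ∀ (x : State N) (t : ℝ), f x (t + T) = f x t) (hxs : Continuous xs)
    (hxsT : Function.Periodic xs T) (k : ℝ) {r : ℝ} (hr : 0 < r)
    (hlin : ∀ t ∈ Icc 0 T, ∀ u v : State N, ‖u‖ ≤ r → ‖v‖ ≤ r →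
      ‖f (xs t + u) t - f (xs t + v) t - linearization f xs t (u - v)‖ ≤ 1 * ‖u - v‖)
    {φ : ℝ → State N} (hφ : ContinuousOn φ (Icc 0 T)) :
    ∃ w : ℝ → State N, (∀ τ ∈ Icc 0 T, w (τ - T) = φ τ) ∧
      (∀ s, ContinuousOn w (Icc (-T) s)) ∧
      ∀ s, ∀ t ∈ Icc 0 s,
        HasDerivWithinAt w (clampedField f xs k r t (w t) (w (t - T))) (Icc 0 s) t := by
  have step : ∀ g : {g : ℝ → State N // ContinuousOn g (Icc 0 T)},
      ∃ u : {u : ℝ → State N // ContinuousOn u (Icc 0 T)}, u.1 0 = g.1 T ∧ ∀ t ∈ Icc 0 T,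
        HasDerivWithinAt u.1 (clampedField f xs k r t (u.1 t) (g.1 t)) (Icc 0 T) t := by
    intro g
    obtain ⟨u, hu0, hu⟩ := exists_clamped_segment hf hT hxs k hr hlin g.2 (g.1 T)
    exact ⟨⟨u, fun t ht => (hu t ht).continuousWithinAt⟩, hu0, hu⟩
  choose next hnext0 hnext using step
  let v : ℕ → {g : ℝ → State N // ContinuousOn g (Icc 0 T)} := fun n => next^[n] ⟨φ, hφ⟩
  have hv : ∀ n, v (n + 1) = next (v n) := fun n => Function.iterate_succ_apply' _ _ _
  have hjoin : ∀ j, (v (j + 1)).1 0 = (v j).1 T := fun j => by rw [hv, hnext0]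
  set w := concatSegments T (fun n => (v n).1) with hw
  have hwv : ∀ (j : ℕ) (τ : ℝ), τ ∈ Icc 0 T → w (j * T - T + τ) = (v j).1 τ := fun j τ hτ =>
    concatSegments_add hT hjoin j hτ
  have hw0 : ∀ τ ∈ Icc 0 T, w (τ - T) = φ τ := by
    intro τ hτ
    have := hwv 0 τ hτ
    rwa [Nat.cast_zero, zero_mul, zero_sub, neg_add_eq_sub] at this
  have hseg : ∀ j : ℕ, ∀ t ∈ Icc (j * T) ((j + 1) * T),
      HasDerivWithinAt w (clampedField f xs k r t (w t) (w (t - T)))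
        (Icc (j * T) ((j + 1) * T)) t := by
    intro j t ht
    have hmaps : MapsTo (fun s => s - j * T) (Icc (j * T) ((j + 1) * T)) (Icc 0 T) :=
      fun s hs => ⟨by linarith [hs.1], by nlinarith [hs.2]⟩
    have heq : ∀ s ∈ Icc (j * T) ((j + 1) * T), w s = (v (j + 1)).1 (s - j * T) := by
      intro s hs
      rw [← hwv (j + 1) _ (hmaps hs)]
      push_cast
      congr 1
      ring
    have hdel : w (t - T) = (v j).1 (t - j * T) := by
      rw [← hwv j _ (hmaps ht)]
      congr 1
      ring
    have h1 := hnext (v j) _ (hmaps ht)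
    rw [← hv, clampedField_sub_mul hfT hxsT, ← heq t ht, ← hdel] at h1
    have h2 := h1.scomp t ((hasDerivWithinAt_id t (Icc (j * T) ((j + 1) * T))).sub_const (j * T))
      hmaps
    rw [one_smul] at h2
    exact h2.congr heq (heq t ht)
  have hder : ∀ s, ∀ t ∈ Icc 0 s,
      HasDerivWithinAt w (clampedField f xs k r t (w t) (w (t - T))) (Icc 0 s) t := by
    intro s t ht
    obtain ⟨n, hn⟩ := exists_nat_segment hT (s := s)
    exact (hasDerivWithinAt_Icc_of_segments hT.le hseg n t ⟨ht.1, ht.2.trans hn⟩).mono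
      (Icc_subset_Icc_right hn)
  refine ⟨w, hw0, fun s => ?_, hder⟩
  have h1 : ContinuousOn w (Icc (-T) 0) := by
    have h2 : ContinuousOn (fun t => φ (t + T)) (Icc (-T) 0) :=
      hφ.comp (by fun_prop) fun t ht => ⟨by linarith [ht.1], by linarith [ht.2]⟩
    refine h2.congr fun t ht => ?_
    change w t = φ (t + T)
    rw [← hw0 (t + T) ⟨by linarith [ht.1], by linarith [ht.2]⟩, add_sub_cancel_right]
  have h2 : ContinuousOn w (Icc 0 s) := fun t ht => (hder s t ht).continuousWithinAt
  refine (h1.union_of_isClosed h2 isClosed_Icc isClosed_Icc).mono fun t ht => ?_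
  rcases le_total t 0 with h | h
  exacts [Or.inl ⟨ht.1, h⟩, Or.inr ⟨h, ht.2⟩]

/-- The clamp is inactive while `‖w‖ ≤ r`, and the control vanishes on `xs` by periodicity. -/
theorem isControlledSolution_of_clamped (hxs : IsPeriodicSolution f T xs) {k r s : ℝ}
    (hr : 0 < r) {w : ℝ → State N} (hwc : ContinuousOn w (Icc (-T) s))
    (hw : ∀ t ∈ Icc 0 s,
      HasDerivWithinAt w (clampedField f xs k r t (w t) (w (t - T))) (Icc 0 s) t)
    (hwr : ∀ t ∈ Icc 0 s, ‖w t‖ ≤ r) :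
    IsControlledSolution f k T s fun t => xs t + w t := by
  refine ⟨hxs.continuous.continuousOn.add hwc, fun t ht => ?_⟩
  refine ((hxs.2 t).hasDerivWithinAt.add (hw t ht)).congr_deriv ?_
  have h1 : xs (t - T) = xs t := hxs.1.sub_eq t
  simp only [clampedField, radialClamp_of_norm_le hr (hwr t ht), h1]
  module

/-- Under stability, solutions of the clamped equation with small initial data stay small. -/
theorem norm_lt_of_stable (hT : 0 < T) (hxs : IsPeriodicSolution f T xs) {k r δ : ℝ} (hr : 0 < r)
    (hδr : δ ≤ r)
    (hδ : ∀ (s : ℝ) (x : ℝ → State N), IsControlledSolution f k T s x →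
      (∀ θ ∈ Icc (-T) 0, ‖x θ - xs θ‖ < δ) → ∀ t ∈ Icc 0 s, ‖x t - xs t‖ < r)
    {w : ℝ → State N} (hwc : ∀ s, ContinuousOn w (Icc (-T) s))
    (hw : ∀ s, ∀ t ∈ Icc 0 s,
      HasDerivWithinAt w (clampedField f xs k r t (w t) (w (t - T))) (Icc 0 s) t)
    (hw0 : ∀ θ ∈ Icc (-T) 0, ‖w θ‖ < δ) : ∀ t, -T ≤ t → ‖w t‖ < r := by
  intro b hb
  rcases le_total b 0 with hb0 | hb0
  · exact (hw0 b ⟨hb, hb0⟩).trans_le hδr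
  by_contra! hcon
  -- At the first time `s` with `‖w s‖ ≥ r`, the clamp has been inactive on all of `[0, s]`, so `xs
  -- + w` is a true controlled solution and stability yields `‖w s‖ < r`.
  let S : Set ℝ := {t ∈ Icc 0 b | r ≤ ‖w t‖}
  have hcb : ContinuousOn (fun t => ‖w t‖) (Icc 0 b) :=
    ((hwc b).mono (Icc_subset_Icc_left (by linarith))).norm
  have hSc : IsCompact S := by
    have : IsClosed S := hcb.preimage_isClosed_of_isClosed isClosed_Icc isClosed_Ici
    exact isCompact_Icc.of_isClosed_subset this fun t ht => ht.1
  obtain ⟨s, hs, hmin⟩ := hSc.exists_isLeast ⟨b, ⟨hb0, le_rfl⟩, hcon⟩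
  have hlt : ∀ t ∈ Ico 0 s, ‖w t‖ ≤ r := by
    intro t ht
    by_contra! h
    exact absurd (hmin ⟨⟨ht.1, ht.2.le.trans hs.1.2⟩, h.le⟩) (not_le.2 ht.2)
  have hle : ∀ t ∈ Icc 0 s, ‖w t‖ ≤ r := by
    rcases hs.1.1.eq_or_lt with h0 | h0
    · intro t ht
      rw [← h0, Icc_self, mem_singleton_iff] at ht
      rw [ht]
      exact ((hw0 0 ⟨by linarith, le_rfl⟩).trans_le hδr).le
    · rw [← closure_Ico h0.ne]
      refine fun t ht => le_on_closure hlt ?_ continuousOn_const ht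
      rw [closure_Ico h0.ne]
      exact hcb.mono (Icc_subset_Icc_right hs.1.2)
  have hsol := isControlledSolution_of_clamped hxs hr (hwc s) (hw s) hle
  have := hδ s _ hsol (by simpa using hw0) s ⟨hs.1.1, le_rfl⟩
  rw [add_sub_cancel_left] at this
  exact absurd hs.2 (not_le.2 this)

end Controlled

/-! ### Passage between real and complex operators -/

section Complexification

variable {N : ℕ}

/-- The inclusion of `ℝ^N` into `ℂ^N`. -/
noncomputable def complexify (N : ℕ) : State N →L[ℝ] EuclideanSpace ℂ (Fin N) :=
  LinearMap.toContinuousLinearMap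
    { toFun := fun x => WithLp.toLp 2 fun i => ((x i : ℝ) : ℂ)
      map_add' := fun x y => by ext i; simp
      map_smul' := fun c x => by ext i; simp }

theorem complexify_apply (x : State N) (i : Fin N) : complexify N x i = ((x i : ℝ) : ℂ) := rfl

theorem norm_complexify (x : State N) : ‖complexify N x‖ = ‖x‖ := by
  simp [EuclideanSpace.norm_eq, complexify_apply]

theorem toMatrix_mulVec_state (L : State N →L[ℝ] State N) (x : State N) (i : Fin N) :
    (LinearMap.toMatrix (EuclideanSpace.basisFun (Fin N) ℝ).toBasis
      (EuclideanSpace.basisFun (Fin N) ℝ).toBasis (L : State N →ₗ[ℝ] State N)).mulVec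
        (fun j => x j) i = L x i := by
  have h := congrFun (LinearMap.toMatrix_mulVec_repr (EuclideanSpace.basisFun (Fin N) ℝ).toBasis
    (EuclideanSpace.basisFun (Fin N) ℝ).toBasis (L : State N →ₗ[ℝ] State N) x) i
  simpa using! h

theorem exists_complexified_operator (L : State N →L[ℝ] State N) :
    ∃ M : EuclideanSpace ℂ (Fin N) →L[ℂ] EuclideanSpace ℂ (Fin N),
      ∀ x, M (complexify N x) = complexify N (L x) := by
  refine ⟨LinearMap.toContinuousLinearMap (Matrix.toEuclideanLin (complexMatrix L)), fun x => ?_⟩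
  ext i
  rw [complexify_apply, ← toMatrix_mulVec_state]
  simp only [LinearMap.coe_toContinuousLinearMap', Matrix.toLpLin_apply, Matrix.mulVec,
    dotProduct, complexMatrix, Matrix.map_apply, complexify_apply]
  push_cast
  rfl

/-- Since `L` and `μ` are real, the real and imaginary parts of a complex eigenvector each solve the
eigenvalue equation, and one of them is nonzero. -/
theorem exists_real_eigenvector {L : State N →L[ℝ] State N} {μ : ℝ}
    (h : Module.End.HasEigenvalue (Matrix.toLin' (complexMatrix L)) (μ : ℂ)) :
    ∃ v : State N, v ≠ 0 ∧ L v = μ • v := by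
  obtain ⟨w, hw⟩ := h.exists_hasEigenvector
  have hB : ∀ i, ∑ j, complexMatrix L i j * w j = (μ : ℂ) * w i := fun i => by
    simpa [Matrix.mulVec, dotProduct] using congrFun hw.apply_eq_smul i
  have hpart : ∀ x : State N, (∀ i, L x i = μ * x i) → L x = μ • x := fun x hx => by
    ext i; simpa using hx i
  by_cases hre : ∀ i, (w i).re = 0
  · refine ⟨WithLp.toLp 2 fun i => (w i).im, fun h0 => hw.2 ?_, hpart _ fun i => ?_⟩
    · ext i
      exact Complex.ext (hre i) (congrArg (fun x : State N => x i) h0)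
    · rw [← toMatrix_mulVec_state]
      have := congrArg Complex.im (hB i)
      simpa [Matrix.mulVec, dotProduct, complexMatrix] using this
  · refine ⟨WithLp.toLp 2 fun i => (w i).re, fun h0 => hre fun i => ?_, hpart _ fun i => ?_⟩
    · exact congrArg (fun x : State N => x i) h0
    · rw [← toMatrix_mulVec_state]
      have := congrArg Complex.re (hB i)
      simpa [Matrix.mulVec, dotProduct, complexMatrix] using this

end Complexification

/-! ### The nonlinear period map in moving coordinates -/

section Perturbation

variable {V : Type*} [NormedAddCommGroup V] [NormedSpace ℂ V] [CompleteSpace V]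

/-- Restriction of a continuous function to `[0, T]`. -/
def restrictSegment {T : ℝ} (p : ℝ → V) (hp : ContinuousOn p (Icc 0 T)) : C(Icc 0 T, V) :=
  ⟨(Icc 0 T).domRestrict p, hp.domRestrict⟩

omit [NormedSpace ℂ V] [CompleteSpace V] in
theorem restrictSegment_apply {T : ℝ} (p : ℝ → V) (hp : ContinuousOn p (Icc 0 T)) (t : Icc 0 T) :
    restrictSegment p hp t = p t := rfl

/-- `q` minus the image of `p` vanishes at `0` and has derivative `ρ`; the mean value inequality
does the rest. -/
theorem norm_restrictSegment_sub_segmentOperator_le {T : ℝ} (hT : 0 ≤ T) {M : V →L[ℂ] V}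
    {k ε : ℝ} {p q ρ : ℝ → V} (hp : ContinuousOn p (Icc 0 T)) (hq : ContinuousOn q (Icc 0 T))
    (h0 : q 0 = M (p T))
    (hd : ∀ t ∈ Icc 0 T, HasDerivWithinAt q (ρ t - (k : ℂ) • p t) (Icc 0 T) t)
    (hρ : ∀ t ∈ Icc 0 T, ‖ρ t‖ ≤ ε) :
    ‖restrictSegment q hq - segmentOperator hT M k (restrictSegment p hp)‖ ≤ ε * T := by
  have hε : 0 ≤ ε := (norm_nonneg _).trans (hρ 0 ⟨le_rfl, hT⟩)
  refine (ContinuousMap.norm_le _ (by positivity)).2 fun t => ?_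
  set e := IccExtend hT (restrictSegment p hp) with he
  have hec : Continuous e := continuous_IccExtend_coe hT _
  have hep : ∀ s ∈ Icc 0 T, e s = p s := fun s hs => IccExtend_of_mem hT _ hs
  have hder : ∀ s ∈ Icc 0 T, HasDerivWithinAt
      (fun s => q s - (M (p T) - (k : ℂ) • ∫ x in (0 : ℝ)..s, e x)) (ρ s) (Icc 0 T) s := by
    intro s hs
    have h1 : HasDerivAt (fun s => M (p T) - (k : ℂ) • ∫ x in (0 : ℝ)..s, e x)
        (-((k : ℂ) • e s)) s :=
      ((hec.integral_hasStrictDerivAt 0 s).hasDerivAt.const_smul (k : ℂ)).const_sub _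
    refine ((hd s hs).sub h1.hasDerivWithinAt).congr_deriv ?_
    rw [hep s hs]; abel
  have hmv := (convex_Icc (0 : ℝ) T).norm_image_sub_le_of_norm_hasDerivWithin_le hder hρ
    (⟨le_rfl, hT⟩ : (0 : ℝ) ∈ Icc 0 T) t.2
  simp only [intervalIntegral.integral_same, smul_zero, sub_zero, h0, sub_self, Real.norm_eq_abs,
    abs_of_nonneg t.2.1] at hmv
  exact hmv.trans (mul_le_mul_of_nonneg_left t.2.2 hε)

end Perturbation

section Pullback

variable {E : Type*} [NormedAddCommGroup E] [NormedSpace ℝ E]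

/-- The curve `u` in the moving coordinates given by `exp (k τ) Z(τ)⁻¹`. -/
noncomputable def pullback (k : ℝ) (Z : ℝ → (E →L[ℝ] E)) (u : ℝ → E) (τ : ℝ) : E :=
  Real.exp (-(k * τ)) • Z τ (u τ)

/-- The moving frame absorbs `A u + k u`. For the deviation equation only the delayed term and the
nonlinear remainder survive. -/
theorem HasDerivWithinAt.pullback {k : ℝ} {A Z : ℝ → (E →L[ℝ] E)} {u : ℝ → E} {u' : E} {s : Set ℝ}
    {t : ℝ} (hZ : HasDerivWithinAt Z (-(Z t * A t)) s t) (hu : HasDerivWithinAt u u' s t) :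
    HasDerivWithinAt (pullback k Z u)
      (Real.exp (-(k * t)) • Z t (u' - A t (u t) - k • u t)) s t := by
  have h1 : HasDerivWithinAt (fun τ : ℝ => Real.exp (-(k * τ)))
      (Real.exp (-(k * t)) * -(k * 1)) s t :=
    (((hasDerivAt_id t).const_mul k).neg.exp).hasDerivWithinAt
  refine (h1.smul (hZ.clm_apply hu)).congr_deriv ?_
  simp only [neg_apply, mul_apply_eq_comp, map_sub, map_smul]
  module

theorem exp_mul_le_exp_abs_mul (k : ℝ) {T t : ℝ} (ht : t ∈ Icc 0 T) :
    Real.exp (k * t) ≤ Real.exp (|k| * T) ∧ Real.exp (-(k * t)) ≤ Real.exp (|k| * T) := by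
  have h1 : |k * t| ≤ |k| * T := by
    rw [abs_mul, abs_of_nonneg ht.1]
    exact mul_le_mul_of_nonneg_left ht.2 (abs_nonneg k)
  exact ⟨Real.exp_le_exp.2 ((le_abs_self _).trans h1), Real.exp_le_exp.2 ((neg_le_abs _).trans h1)⟩

/-- Moving coordinates distort norms by a bounded factor on `[0, T]`. -/
theorem exists_pullback_bounds (k : ℝ) {T : ℝ} (hT : 0 ≤ T) {Y Z : ℝ → (E →L[ℝ] E)}
    (hY : ContinuousOn Y (Icc 0 T)) (hZ : ContinuousOn Z (Icc 0 T))
    (hYZ : ∀ t ∈ Icc 0 T, Y t * Z t = 1) :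
    ∃ C > 0, (∀ t ∈ Icc 0 T, ∀ x, ‖Real.exp (-(k * t)) • Z t x‖ ≤ C * ‖x‖) ∧
      ∀ t ∈ Icc 0 T, ∀ x, ‖x‖ ≤ C * ‖Real.exp (-(k * t)) • Z t x‖ := by
  obtain ⟨a, ha⟩ := isCompact_Icc.exists_bound_of_continuousOn hY
  obtain ⟨b, hb⟩ := isCompact_Icc.exists_bound_of_continuousOn hZ
  have h0 : (0 : ℝ) ∈ Icc 0 T := ⟨le_rfl, hT⟩
  have ha0 : 0 ≤ a := (norm_nonneg _).trans (ha 0 h0)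
  have hb0 : 0 ≤ b := (norm_nonneg _).trans (hb 0 h0)
  have hE := Real.exp_pos (|k| * T)
  refine ⟨Real.exp (|k| * T) * (a + b + 1), by positivity, fun t ht x => ?_, fun t ht x => ?_⟩
  · rw [norm_smul, Real.norm_of_nonneg (Real.exp_pos _).le, mul_assoc]
    refine mul_le_mul (exp_mul_le_exp_abs_mul k ht).2 ?_ (norm_nonneg _) hE.le
    exact ((Z t).le_of_opNorm_le (hb t ht) x).trans
      (mul_le_mul_of_nonneg_right (by linarith) (norm_nonneg x))
  · have h1 : x = Real.exp (k * t) • Y t (Real.exp (-(k * t)) • Z t x) := by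
      rw [map_smul, smul_smul, ← Real.exp_add, add_neg_cancel, Real.exp_zero, one_smul,
        ← mul_apply_eq_comp, hYZ t ht, one_apply_eq_self]
    conv_lhs => rw [h1]
    rw [norm_smul, Real.norm_of_nonneg (Real.exp_pos _).le, mul_assoc]
    refine mul_le_mul (exp_mul_le_exp_abs_mul k ht).1 ?_ (norm_nonneg _) hE.le
    exact ((Y t).le_of_opNorm_le (ha t ht) _).trans
      (mul_le_mul_of_nonneg_right (by linarith) (norm_nonneg _))

end Pullback

/-! ### The orbit of segments and the contradiction -/

section Main

variable {N : ℕ} {f : State N → ℝ → State N} {T : ℝ} {xs : ℝ → State N}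

/-- One period of the deviation equation, in moving coordinates, is a small perturbation of the
segment operator. -/
theorem norm_pullback_segment_sub_le (hT : 0 ≤ T) {k r η C : ℝ} (hr : 0 < r)
    {L : State N →L[ℝ] State N}
    {M : EuclideanSpace ℂ (Fin N) →L[ℂ] EuclideanSpace ℂ (Fin N)}
    (hM : ∀ x, M (complexify N x) = complexify N (L x))
    {Y Z : ℝ → (State N →L[ℝ] State N)} (hL : L = Real.exp (k * T) • Y T) (hZ0 : Z 0 = 1)
    (hYZ : Y T * Z T = 1)
    (hZ : ∀ t ∈ Icc 0 T, HasDerivWithinAt Z (-(Z t * linearization f xs t)) (Icc 0 T) t)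
    (hC0 : 0 ≤ C) (hη : 0 ≤ η)
    (hC : ∀ t ∈ Icc 0 T, ∀ x, ‖Real.exp (-(k * t)) • Z t x‖ ≤ C * ‖x‖)
    (hC' : ∀ t ∈ Icc 0 T, ∀ x, ‖x‖ ≤ C * ‖Real.exp (-(k * t)) • Z t x‖)
    (hlin : ∀ t ∈ Icc 0 T, ∀ u : State N, ‖u‖ ≤ r →
      ‖f (xs t + u) t - f (xs t) t - linearization f xs t u‖ ≤ η * ‖u‖)
    {u v : ℝ → State N} (huv : v 0 = u T)
    (hv : ∀ t ∈ Icc 0 T,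
      HasDerivWithinAt v (clampedField f xs k r t (v t) (u t)) (Icc 0 T) t)
    (hvr : ∀ t ∈ Icc 0 T, ‖v t‖ ≤ r)
    (hp : ContinuousOn (fun t => complexify N (pullback k Z u t)) (Icc 0 T))
    (hq : ContinuousOn (fun t => complexify N (pullback k Z v t)) (Icc 0 T)) :
    ‖restrictSegment _ hq - segmentOperator hT M k (restrictSegment _ hp)‖ ≤
      C * (η * (C * ‖restrictSegment _ hq‖)) * T := by
  refine norm_restrictSegment_sub_segmentOperator_le hT hp hq
    (ρ := fun t => complexify N (Real.exp (-(k * t)) •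
      Z t (f (xs t + v t) t - f (xs t) t - linearization f xs t (v t)))) ?_ ?_ ?_
  · rw [hM, hL]
    simp only [pullback, huv, hZ0, mul_zero, neg_zero, Real.exp_zero, one_smul, one_apply_eq_self,
      smul_apply, map_smul]
    rw [smul_smul, ← Real.exp_add, neg_add_cancel, Real.exp_zero, one_smul,
      ← mul_apply_eq_comp, hYZ, one_apply_eq_self]
  · intro t ht
    have h1 := (complexify N).hasFDerivAt.comp_hasDerivWithinAt t
      (HasDerivWithinAt.pullback (k := k) (hZ t ht) (hv t ht))
    refine h1.congr_deriv ?_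
    have h2 : (k : ℂ) • complexify N (pullback k Z u t) =
        complexify N (k • pullback k Z u t) := by
      ext i; simp [complexify_apply]
    rw [h2, ← map_sub]
    congr 1
    rw [pullback, clampedField, radialClamp_of_norm_le hr (hvr t ht)]
    simp only [map_sub, map_add, map_smul]
    module
  · intro t ht
    rw [norm_complexify]
    refine (hC t ht _).trans (mul_le_mul_of_nonneg_left ((hlin t ht _ (hvr t ht)).trans ?_) hC0)
    refine mul_le_mul_of_nonneg_left ((hC' t ht _).trans ?_) hη
    refine mul_le_mul_of_nonneg_left ?_ hC0
    have h3 := (restrictSegment _ hq).norm_coe_le_norm ⟨t, ht⟩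
    rwa [restrictSegment_apply, norm_complexify] at h3

/-- The nonlinear remainder is controlled by the new segment `x'`. For `θ ≤ 1 / 2` it can be
absorbed, `‖x'‖ ≤ 2 ‖U‖ ‖x‖`, which gives an error relative to the old segment. -/
theorem norm_sub_le_of_norm_sub_le_mul {X : Type*} [NormedAddCommGroup X] [NormedSpace ℂ X]
    (U : X →L[ℂ] X) {x x' : X} {θ η : ℝ} (hθ : 0 ≤ θ) (hθ1 : θ ≤ 1 / 2)
    (hθη : θ * (2 * ‖U‖) ≤ η) (h : ‖x' - U x‖ ≤ θ * ‖x'‖) : ‖x' - U x‖ ≤ η * ‖x‖ := by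
  have h1 := norm_sub_norm_le x' (U x)
  have h2 := U.le_opNorm x
  have h3 : ‖x'‖ ≤ 2 * ‖U‖ * ‖x‖ := by
    have := mul_le_mul_of_nonneg_right hθ1 (norm_nonneg x')
    linarith
  calc _ ≤ θ * ‖x'‖ := h
    _ ≤ θ * (2 * ‖U‖ * ‖x‖) := mul_le_mul_of_nonneg_left h3 hθ
    _ = θ * (2 * ‖U‖) * ‖x‖ := by ring
    _ ≤ _ := mul_le_mul_of_nonneg_right hθη (norm_nonneg x)

end Main

theorem mainTheorem8 (N : ℕ) (f : State N → ℝ → State N)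
    (hf : ContDiff ℝ 1 (fun p : State N × ℝ => f p.1 p.2))
    (T : ℝ) (hT : 0 < T) (hfT : ∀ (x : State N) (t : ℝ), f x (t + T) = f x t)
    (xs : ℝ → State N) (hxs : IsPeriodicSolution f T xs)
    (hμ : ∃ μ : ℝ, 1 < μ ∧ IsFloquetMultiplier (linearization f xs) T (μ : ℂ)) :
    ∀ k : ℝ, IsControlledUnstable f k T xs := by
  intro k hstab
  obtain ⟨μ, hμ1, Y, ⟨hY0, hY⟩, heig⟩ := hμ
  obtain ⟨v, hv0, hv⟩ := exists_real_eigenvector heig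
  have hxc := hxs.continuous
  have hAc : Continuous (linearization f xs) :=
    (continuous_fderiv_fst_slice hf).comp (hxc.prodMk continuous_id)
  obtain ⟨Z, hYZ, hZ⟩ := exists_inverse_fundamental_solution hAc hY0 hY
  have hT0 : T ∈ Icc 0 T := ⟨hT.le, le_rfl⟩
  have hZ' : ∀ t ∈ Icc 0 T, HasDerivWithinAt Z (-(Z t * linearization f xs t)) (Icc 0 T) t :=
    fun t ht => (hZ t ht.1).mono Icc_subset_Ici_self
  have hYc : ContinuousOn Y (Icc 0 T) := fun t ht =>
    ((hY t ht.1).mono Icc_subset_Ici_self).continuousWithinAt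
  have hZc : ContinuousOn Z (Icc 0 T) := fun t ht => (hZ' t ht).continuousWithinAt
  have hZ0 : Z 0 = 1 := by
    have h := (hYZ 0 le_rfl).1
    rw [hY0] at h
    rwa [← mul_one (Z 0)]
  obtain ⟨C, hC0, hC, hC'⟩ := exists_pullback_bounds k hT.le hYc hZc fun t ht => (hYZ t ht.1).2
  obtain ⟨M, hM⟩ := exists_complexified_operator (Real.exp (k * T) • Y T)
  obtain ⟨lam, hlam1, hlam⟩ := exists_one_lt_root_characteristic hμ1 (k * T)
  have hlam0 : lam ≠ 0 := by linarith
  set y : C(Icc 0 T, EuclideanSpace ℂ (Fin N)) := expSegment T k lam (complexify N v) with hy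
  set U := segmentOperator hT.le M k with hU
  have hUy : U y = (lam : ℂ) • y := by
    refine segmentOperator_expSegment hT.le hlam0 (m := Real.exp (k * T) * μ) ?_ ?_
    · rw [mul_comm (Real.exp _), mul_assoc, ← Real.exp_add, ← hlam]
      congr 2
      rw [hlam]
      field_simp
      ring
    · rw [hM]
      ext i
      simp [complexify_apply, hv, mul_assoc]
  have hy0 : y ≠ 0 := by
    intro h
    have h1 := congrArg (fun z : C(Icc 0 T, EuclideanSpace ℂ (Fin N)) => ‖z ⟨0, le_rfl, hT.le⟩‖) h
    simp [hy, expSegment, norm_complexify, hv0] at h1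
  obtain ⟨η, hη, horbit⟩ := IsCompactOperator.exists_forall_orbit_unbounded
    (isCompactOperator_segmentOperator hT.le M k) (lam := (lam : ℂ)) (by rw [Complex.norm_real, Real.norm_eq_abs, abs_of_pos] <;> linarith)
    hy0 hUy
  obtain ⟨θ, hθ0, hθ1, hθη⟩ : ∃ θ : ℝ, 0 < θ ∧ θ ≤ 1 / 2 ∧ θ * (2 * ‖U‖) ≤ η := by
    refine ⟨min (1 / 2) (η / (2 * ‖U‖ + 1)), by positivity, min_le_left _ _, ?_⟩
    calc _ ≤ η / (2 * ‖U‖ + 1) * (2 * ‖U‖ + 1) :=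
          mul_le_mul (min_le_right _ _) (by linarith) (by positivity) (by positivity)
      _ = η := by field_simp
  -- Two factors `C` come from entering and leaving the moving coordinates, `T` from integrating
  -- over a period; `ν ≤ 1` meets the hypothesis of `exists_clamped_solution`.
  set ν : ℝ := min 1 (θ / (C * C * T)) with hν
  have hν0 : 0 < ν := by positivity
  have hνθ : C * (ν * C) * T ≤ θ := by
    calc C * (ν * C) * T = ν * (C * C * T) := by ring
      _ ≤ θ / (C * C * T) * (C * C * T) :=
        mul_le_mul_of_nonneg_right (min_le_right _ _) (by positivity)
      _ = θ := by field_simp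
  obtain ⟨r, hr, hlin⟩ := exists_radius_norm_sub_fderiv_le hf hxc T hν0
  obtain ⟨δ, hδ, hstable⟩ := hstab r hr
  -- `φ` is the segment whose pullback is the eigenfunction `y`.
  let φ : ℝ → State N := fun τ => Real.exp (k * τ) • Y τ (Real.exp (-(k / lam) * τ) • v)
  have hφ : ContinuousOn φ (Icc 0 T) := by
    have h1 : ContinuousOn (fun τ => Y τ (Real.exp (-(k / lam) * τ) • v)) (Icc 0 T) :=
      hYc.clm_apply (by fun_prop)
    have h2 : Continuous fun τ : ℝ => Real.exp (k * τ) := by fun_prop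
    exact h2.continuousOn.smul h1
  obtain ⟨b, hb⟩ := isCompact_Icc.exists_bound_of_continuousOn hφ
  have hb0 : 0 ≤ b := (norm_nonneg _).trans (hb T hT0)
  -- This scaling makes the history `c φ` smaller than `min δ r`. The orbit must then exceed `C r`
  -- at step `J`, although solutions bounded by `r` have pullbacks bounded by `C r`.
  set c : ℝ := min δ r / (b + 1) with hc
  have hc0 : 0 < c := by positivity
  obtain ⟨J, hJ⟩ := horbit (c : ℂ) (by exact_mod_cast hc0.ne') (C * r)
  obtain ⟨w, hw0, hwc, hw⟩ := exists_clamped_solution hf hT hfT hxc hxs.1 k hr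
    (fun t ht x x' hx hx' => (hlin t ht x x' hx hx').trans
      (mul_le_mul_of_nonneg_right (min_le_left _ _) (norm_nonneg _)))
    (hφ.const_smul c)
  have hw0' : ∀ θ ∈ Icc (-T) 0, ‖w θ‖ < min δ r := by
    intro θ hθ
    have hmem : θ + T ∈ Icc 0 T := ⟨by linarith [hθ.1], by linarith [hθ.2]⟩
    have h1 := hw0 _ hmem
    rw [add_sub_cancel_right] at h1
    rw [h1, Pi.smul_apply, norm_smul, Real.norm_of_nonneg hc0.le]
    calc c * ‖φ (θ + T)‖ ≤ c * b := mul_le_mul_of_nonneg_left (hb _ hmem) hc0.le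
      _ < c * (b + 1) := by nlinarith
      _ = min δ r := by rw [hc]; field_simp
  have hsmall := norm_lt_of_stable hT hxs hr (min_le_right δ r)
    (fun s x hx hx0 => hstable s x hx fun θ hθ => (hx0 θ hθ).trans_le (min_le_left _ _))
    hwc hw hw0'
  let u : ℕ → ℝ → State N := fun j τ => w (j * T - T + τ)
  have hjT : ∀ j : ℕ, 0 ≤ (j : ℝ) * T := fun j => by positivity
  have hur : ∀ j, ∀ t ∈ Icc 0 T, ‖u j t‖ ≤ r := fun j t ht =>
    (hsmall _ (by linarith [hjT j, ht.1])).le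
  have huc : ∀ j, ContinuousOn (u j) (Icc 0 T) := fun j =>
    (hwc (j * T)).comp (by fun_prop) fun t ht =>
      ⟨by linarith [hjT j, ht.1], by linarith [ht.2]⟩
  have hud : ∀ j, ∀ t ∈ Icc 0 T, HasDerivWithinAt (u (j + 1))
      (clampedField f xs k r t (u (j + 1) t) (u j t)) (Icc 0 T) t := by
    intro j t ht
    have hmaps : MapsTo (fun τ : ℝ => ((j + 1 : ℕ) : ℝ) * T - T + τ) (Icc 0 T)
        (Icc 0 (((j + 1 : ℕ) : ℝ) * T)) := by
      intro τ hτ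
      push_cast
      exact ⟨by linarith [hjT j, hτ.1], by linarith [hτ.2]⟩
    have h1 := (hw _ _ (hmaps ht)).scomp t
      ((hasDerivWithinAt_id t (Icc 0 T)).const_add (((j + 1 : ℕ) : ℝ) * T - T)) hmaps
    rw [one_smul] at h1
    refine h1.congr_deriv ?_
    -- The time `(j + 1) T - T + t` is shifted back by `j` periods to `t`.
    rw [← clampedField_sub_mul hfT hxs.1 k r _ _ _ j]
    simp only [u]
    push_cast
    congr 1 <;> ring_nf
  have hpc : ∀ j, ContinuousOn (fun t => complexify N (pullback k Z (u j) t)) (Icc 0 T) := by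
    intro j
    have h1 : ContinuousOn (fun t => Z t (u j t)) (Icc 0 T) := hZc.clm_apply (huc j)
    have h2 : Continuous fun τ : ℝ => Real.exp (-(k * τ)) := by fun_prop
    exact (complexify N).continuous.comp_continuousOn (h2.continuousOn.smul h1)
  have hJ' := hJ (fun j => restrictSegment _ (hpc j)) ?_ ?_
  · refine absurd hJ' (not_lt.2 ((ContinuousMap.norm_le _ (by positivity)).2 fun t => ?_))
    rw [restrictSegment_apply, norm_complexify]
    exact (hC t t.2 _).trans (mul_le_mul_of_nonneg_left (hur J t t.2) hC0.le)
  · ext1 t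
    have h1 : u 0 t = c • φ t := by
      simp only [u, Nat.cast_zero, zero_mul, zero_sub, neg_add_eq_sub]
      exact hw0 t t.2
    have h2 : pullback k Z (u 0) t = (c * Real.exp (-(k / lam) * t)) • v := by
      rw [pullback, h1]
      simp only [φ, map_smul, smul_smul]
      rw [← mul_apply_eq_comp, (hYZ t t.2.1).1, one_apply_eq_self]
      congr 1
      rw [Real.exp_neg (k * t)]
      field_simp
    rw [restrictSegment_apply, h2]
    ext i
    simp [hy, expSegment, complexify_apply, mul_assoc]
  · intro j _
    refine norm_sub_le_of_norm_sub_le_mul U hθ0.le hθ1 hθη ?_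
    refine (norm_pullback_segment_sub_le hT.le hr hM rfl hZ0 (hYZ T hT.le).2 hZ' hC0.le hν0.le
      hC hC' (fun t ht x hx => by simpa [linearization] using hlin t ht x 0 hx (by simpa using hr.le))
      (u := u j) ?_ (hud j) (hur (j + 1)) (hpc j) (hpc (j + 1))).trans ?_
    · simp only [u]
      push_cast
      congr 1
      ring
    · calc _ = C * (ν * C) * T * ‖restrictSegment _ (hpc (j + 1))‖ := by ring
        _ ≤ _ := mul_le_mul_of_nonneg_right hνθ (norm_nonneg _)
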